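/- Let $\mathbb L^3$ be $\mathbb R^3$ with the metric $dx^2+dy^2-dz^2$. Let $I,J\subset\mathbb R$ be non-empty open intervals. A smooth parametrized surface $X:I\times J\to\mathbb L^3$ is non-degenerate if its induced metric is non-degenerate at every point, so that it is spacelike (positive definite metric) or timelike (Lorentzian metric). Its Gauss curvature is $K=\epsilon\,\frac{ln-m^2}{EG-F^2}$, where $\epsilon=-1$ if the surface is spacelike, $\epsilon=1$ if it is timelike, and $E,F,G$ and $l,m,n$ are the coefficients of the first and second fundamental forms. The surface is cylindrical if it is a ruled surface whose rulings are all parallel to a fixed direction, that is, if there is a vector $v\neq0$ such that near every point the surface can be reparametrized smoothly as $(u,w)\mapsto\gamma(u)+wv$. 1. Let $X(s,t)=\alpha(s)+\beta(t)$ be a non-degenerate translation surface, with smooth curves $\alpha:I\to\mathbb L^3$ and $\beta:J\to\mathbb L^3$. If $K=0$ everywhere, then the surface is cylindrical. 2. If $X(s,t)=\alpha(s)+\beta(t)$ is a non-degenerate translation surface and one of the curves $\alpha,\beta$ lies in a plane, then $K$ is not equal to a non-zero constant. 3. Let $f:I\to\mathbb R$ and $g:J\to\mathbb R$ be smooth,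 and let $X$ be a non-degenerate homothetical surface, that is, one of the graphs $z=f(x)g(y)$, $x=f(y)g(z)$, $y=f(x)g(z)$. If its Gauss curvature $K$ is constant, then $K=0$, and one of the following holds: (a) the surface is cylindrical, its base curves can be taken in one of the three coordinate planes, and its rulings are orthogonal to this plane; (b) there are real $a,b,c\neq0$ with $f(x)g(y)=a\,e^{bx+cy}$ for all $x\in I$, $y\in J$; (c) there are a sign $\sigma\in\{1,-1\}$ and real numbers $b,c,d,e,m$ with $b,c\neq0$ and $m\neq0,1$ such that $$f(x)g(y)=\sigma\left(\frac{bx}{m}+d\right)^{m}\left(\frac{cy}{m-1}+e\right)^{1-m}\qquad\text{for all }x\in I,\ y\in J,$$ where both powers are defined in the elementary sense: at each point the base is positive, or the exponent is an integer, the base being non-zero if that exponent is negative. -/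

import Mathlib

open Set
open scoped ContDiff

noncomputable section

namespace Lorentz

/-- The underlying vector space of Lorentz-Minkowski space, with coordinates
`x = v 0`, `y = v 1`, `z = v 2`. -/
abbrev L3 : Type := Fin 3 → ℝ

/-- The metric `dx² + dy² - dz²`. -/
def lprod (u v : L3) : ℝ := u 0 * v 0 + u 1 * v 1 - u 2 * v 2

/-- The Lorentzian cross product, characterized by `lprod (lcross u v) w = det (u, v, w)`. -/
def lcross (u v : L3) : L3 :=
  ![u 1 * v 2 - u 2 * v 1, u 2 * v 0 - u 0 * v 2, u 1 * v 0 - u 0 * v 1]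

theorem lprod_lcross (u v w : L3) :
    lprod (lcross u v) w = Matrix.det (Matrix.of ![u, v, w]) := by
  simp [lprod, lcross, Matrix.det_fin_three]
  ring

/-! ### Parametrized surfaces `X = X(s, t)` -/

/-- The partial derivative `X_s`. -/
def dS (X : ℝ × ℝ → L3) (p : ℝ × ℝ) : L3 := fderiv ℝ X p (1, 0)

/-- The partial derivative `X_t`. -/
def dT (X : ℝ × ℝ → L3) (p : ℝ × ℝ) : L3 := fderiv ℝ X p (0, 1)

/-- The metric induced on the parameter domain (the first fundamental form). -/
def firstForm (X : ℝ × ℝ → L3) (p w w' : ℝ × ℝ) : ℝ :=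
  lprod (fderiv ℝ X p w) (fderiv ℝ X p w')

/-- The induced metric is non degenerate at every point of `U`; this forces `X` to be an
immersion on `U`. -/
def IsNondegenerateOn (U : Set (ℝ × ℝ)) (X : ℝ × ℝ → L3) : Prop :=
  ∀ p ∈ U, ∀ w : ℝ × ℝ, (∀ w' : ℝ × ℝ, firstForm X p w w' = 0) → w = 0

/-- The induced metric is positive definite at `p`. A non degenerate surface which is not
spacelike at `p` is timelike at `p`. -/
def IsSpacelikeAt (X : ℝ × ℝ → L3) (p : ℝ × ℝ) : Prop :=
  ∀ w : ℝ × ℝ, w ≠ 0 → 0 < firstForm X p w w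

open Classical in
/-- The sign `ε`: `-1` on spacelike surfaces, `1` on timelike ones. -/
def causalSign (X : ℝ × ℝ → L3) (p : ℝ × ℝ) : ℝ := if IsSpacelikeAt X p then -1 else 1

def coeffE (X : ℝ × ℝ → L3) (p : ℝ × ℝ) : ℝ := lprod (dS X p) (dS X p)

def coeffF (X : ℝ × ℝ → L3) (p : ℝ × ℝ) : ℝ := lprod (dS X p) (dT X p)

def coeffG (X : ℝ × ℝ → L3) (p : ℝ × ℝ) : ℝ := lprod (dT X p) (dT X p)

/-- The unit normal `X_s × X_t / √|⟨X_s × X_t, X_s × X_t⟩|`. -/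
def unitNormal (X : ℝ × ℝ → L3) (p : ℝ × ℝ) : L3 :=
  (Real.sqrt |lprod (lcross (dS X p) (dT X p)) (lcross (dS X p) (dT X p))|)⁻¹ •
    lcross (dS X p) (dT X p)

/-- The coefficient `l` of the second fundamental form. -/
def coeffL (X : ℝ × ℝ → L3) (p : ℝ × ℝ) : ℝ := lprod (unitNormal X p) (dS (dS X) p)

/-- The coefficient `m` of the second fundamental form. -/
def coeffM (X : ℝ × ℝ → L3) (p : ℝ × ℝ) : ℝ := lprod (unitNormal X p) (dT (dS X) p)

/-- The coefficient `n` of the second fundamental form. -/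
def coeffN (X : ℝ × ℝ → L3) (p : ℝ × ℝ) : ℝ := lprod (unitNormal X p) (dT (dT X) p)

/-- The Gauss curvature `K = ε (l n - m²) / (E G - F²)`. -/
def gaussK (X : ℝ × ℝ → L3) (p : ℝ × ℝ) : ℝ :=
  causalSign X p * ((coeffL X p * coeffN X p - coeffM X p ^ 2) /
    (coeffE X p * coeffG X p - coeffF X p ^ 2))

/-! ### The classes of surfaces -/

def IsOpenInterval (I : Set ℝ) : Prop := IsOpen I ∧ I.OrdConnected ∧ I.Nonempty

/-- The surface is ruled by segments parallel to `v`, with base curves in `P`: around every point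
there is a smooth change of parameters which turns `X` into `(u, w) ↦ γ u + w v`, with `γ` a
smooth curve in `P`. -/
def IsCylindricalAlong (U : Set (ℝ × ℝ)) (X : ℝ × ℝ → L3) (v : L3) (P : Set L3) : Prop :=
  ∀ p ∈ U, ∃ (φ : OpenPartialHomeomorph (ℝ × ℝ) (ℝ × ℝ)) (a b c d : ℝ) (γ : ℝ → L3),
    φ.source = Ioo a b ×ˢ Ioo c d ∧ p ∈ φ.target ∧ φ.target ⊆ U ∧
    ContDiffOn ℝ ∞ φ φ.source ∧ ContDiffOn ℝ ∞ φ.symm φ.target ∧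
    ContDiffOn ℝ ∞ γ (Ioo a b) ∧ (∀ u ∈ Ioo a b, γ u ∈ P) ∧
    ∀ u ∈ Ioo a b, ∀ w ∈ Ioo c d, X (φ (u, w)) = γ u + w • v

/-- A cylindrical surface: a ruled surface whose rulings are all parallel to a fixed direction. -/
def IsCylindrical (U : Set (ℝ × ℝ)) (X : ℝ × ℝ → L3) : Prop :=
  ∃ v : L3, v ≠ 0 ∧ IsCylindricalAlong U X v univ

/-- A cylindrical surface over plane curves contained in one of the three coordinate planes
`{q | q k = 0}`, with rulings orthogonal to this plane. -/
def IsCoordinateCylinder (U : Set (ℝ × ℝ)) (X : ℝ × ℝ → L3) : Prop :=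
  ∃ k : Fin 3, IsCylindricalAlong U X (Pi.single k 1) {q | q k = 0}

/-- The curve `α` restricted to `I` lies in a plane. -/
def IsPlanarOn (I : Set ℝ) (α : ℝ → L3) : Prop :=
  ∃ (ν : L3) (c : ℝ), ν ≠ 0 ∧ ∀ s ∈ I, ν 0 * α s 0 + ν 1 * α s 1 + ν 2 * α s 2 = c

/-- `X(s, t) = α(s) + β(t)` on `I × J`, for smooth curves `α` and `β`. -/
structure IsTranslationSurface (I J : Set ℝ) (α β : ℝ → L3) (X : ℝ × ℝ → L3) : Prop where
  interval_left : IsOpenInterval I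
  interval_right : IsOpenInterval J
  smooth_left : ContDiffOn ℝ ∞ α I
  smooth_right : ContDiffOn ℝ ∞ β J
  eq_sum : X = fun p => α p.1 + β p.2

/-- `X` is the graph over `I × J` of the product of two smooth functions, over one of the three
coordinate planes: `z = f(x) g(y)`, `x = f(y) g(z)` or `y = f(x) g(z)`. -/
structure IsHomotheticalSurface (I J : Set ℝ) (f g : ℝ → ℝ) (X : ℝ × ℝ → L3) : Prop where
  interval_left : IsOpenInterval I
  interval_right : IsOpenInterval J
  smooth_left : ContDiffOn ℝ ∞ f I
  smooth_right : ContDiffOn ℝ ∞ g J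
  eq_graph : (X = fun p => ![p.1, p.2, f p.1 * g p.2]) ∨
    (X = fun p => ![f p.1 * g p.2, p.1, p.2]) ∨
    (X = fun p => ![p.1, f p.1 * g p.2, p.2])

/-- The real power `x ^ r` has its elementary meaning: a positive base, or an integer exponent
(with non-zero base if the exponent is negative). In these cases it is Mathlib's `x ^ r`. -/
def PowDefined (x r : ℝ) : Prop :=
  0 < x ∨ (∃ n : ℕ, r = n) ∨ (x ≠ 0 ∧ ∃ n : ℤ, r = n)

/-- `h(x, y) = a e^(bx + cy)` on `I × J`. -/
def IsExponentialForm (I J : Set ℝ) (h : ℝ → ℝ → ℝ) : Prop :=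
  ∃ a b c : ℝ, a ≠ 0 ∧ b ≠ 0 ∧ c ≠ 0 ∧
    ∀ x ∈ I, ∀ y ∈ J, h x y = a * Real.exp (b * x + c * y)

/-- `h(x, y) = ± (bx/m + d)^m (cy/(m-1) + e)^(1-m)` on `I × J`. -/
def IsPowerForm (I J : Set ℝ) (h : ℝ → ℝ → ℝ) : Prop :=
  ∃ σ b c d e m : ℝ, (σ = 1 ∨ σ = -1) ∧ b ≠ 0 ∧ c ≠ 0 ∧ m ≠ 0 ∧ m ≠ 1 ∧
    (∀ x ∈ I, PowDefined (b * x / m + d) m) ∧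
    (∀ y ∈ J, PowDefined (c * y / (m - 1) + e) (1 - m)) ∧
    ∀ x ∈ I, ∀ y ∈ J,
      h x y = σ * ((b * x / m + d) ^ m * (c * y / (m - 1) + e) ^ (1 - m))

end Lorentz

end

/-!
All three statements rest on the Gauss equation in determinantal form,
`K (E G - F²)² = det(X_s, X_t, X_st)² - det(X_s, X_t, X_ss) det(X_s, X_t, X_tt)`, which is the same
for spacelike and timelike surfaces (`gaussK_mul_gramDet_sq`).

*Flat translation surfaces.* For `X = α(s) + β(t)` with `K = 0` one of `det(α', β', α'')` and
`det(α', β', β'')` vanishes at each point. If one curve has no point of non-zero curvature, it is a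
line, and the surface is a cylinder over the other. Otherwise, at points of non-zero curvature of
both curves, both determinants vanish (`lcross_deriv_eq_zero`), so that all osculating planes there
are parallel to one plane, with normal `ν`. Elsewhere `α''` is a multiple of `α'`, so that
`⟨ν, α'⟩² / |α'|²` has derivative zero everywhere (`lprod_eq_zero_of_collinear`); hence both curves
lie in parallel planes, and the surface is planar. The changes of parameters come from the inverse
function theorem (`isCylindricalAlong_of_eq`).

*Translation surfaces with a planar curve.* Let `K ≠ 0` and let `α'` stay in a plane. Up to scaling,
the Gauss equation reads `ρ(t) Q_t(α')² = κ(s) L_t(α')`, with a quadratic form `Q_t` and a linear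
form `L_t` on the plane. Eliminating `κ` between two values of `t` and using the slope of `α'` as
parameter gives an identity of polynomials. By parity of the degree
(`proportional_of_sq_mul_eq`) all the `L_t`, and all the `Q_t`, are proportional. The first makes
`β'`, suitably normalized, move on a line, and then the second makes a Gram matrix of three
independent vectors singular (`gram_eq_zero_of_minors`).

*Homothetical surfaces, `K ≠ 0`.* The Gauss equation of the graph of `f(x) g(y)` says that the
vectors formed from `f'², f f'', 1, f², f'⁴, f² f'², f⁴` and the same functions of `g` are orthogonal
for a nondegenerate bilinear form on `ℝ⁷`. So one of the two families, say that of `f`, spans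
at most three dimensions, which are those of `1, f², f⁴`; hence `f'² = α + β f²`
(`deriv_sq_eq_affine`), and comparing coefficients of powers of `f²` gives `K = 0`.

*Homothetical surfaces, `K = 0`.* If neither factor is constant, the variables separate into
`f f'' = μ f'²` and `g g'' = μ⁻¹ g'²`. Where `f` has no zero, it is an exponential or a power of an
affine function. A solution which has a zero, but is not identically zero, is a monomial
(`eq_monomial_of_zero`): next to a zero it is `A (x - y)^m`, smoothness makes `m` a natural number,
and then the derivative of order `m + 1` vanishes identically.
-/

namespace Lorentz

/-! ### The Gauss curvature in terms of determinants -/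

theorem fderiv_apply_eq (X : ℝ × ℝ → L3) (p w : ℝ × ℝ) :
    fderiv ℝ X p w = w.1 • dS X p + w.2 • dT X p := by
  have h : w = w.1 • ((1 : ℝ), (0 : ℝ)) + w.2 • ((0 : ℝ), (1 : ℝ)) := by
    ext <;> simp
  conv_lhs => rw [h]
  rw [map_add, map_smul, map_smul]
  rfl

theorem firstForm_eq (X : ℝ × ℝ → L3) (p w w' : ℝ × ℝ) :
    firstForm X p w w' = w.1 * w'.1 * coeffE X p + (w.1 * w'.2 + w.2 * w'.1) * coeffF X p
      + w.2 * w'.2 * coeffG X p := by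
  simp only [firstForm, fderiv_apply_eq, coeffE, coeffF, coeffG, lprod, Pi.add_apply,
    Pi.smul_apply, smul_eq_mul]
  ring

/-- The determinant `E G - F²` of the first fundamental form. -/
noncomputable def gramDet (X : ℝ × ℝ → L3) (p : ℝ × ℝ) : ℝ :=
  coeffE X p * coeffG X p - coeffF X p ^ 2

theorem lprod_lcross_self (u v : L3) :
    lprod (lcross u v) (lcross u v) = -(lprod u u * lprod v v - lprod u v ^ 2) := by
  simp [lprod, lcross]
  ring

theorem gramDet_ne_zero {U : Set (ℝ × ℝ)} {X : ℝ × ℝ → L3} (h : IsNondegenerateOn U X)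
    {p : ℝ × ℝ} (hp : p ∈ U) : gramDet X p ≠ 0 := by
  intro h0
  unfold gramDet at h0
  have key : ∀ w1 w2 : ℝ, w1 * coeffE X p + w2 * coeffF X p = 0 →
      w1 * coeffF X p + w2 * coeffG X p = 0 → w1 = 0 ∧ w2 = 0 := by
    intro w1 w2 h1 h2
    have := h p hp (w1, w2) (fun w' => by
      rw [firstForm_eq]
      linear_combination w'.1 * h1 + w'.2 * h2)
    simpa using this
  have h1 := key (coeffG X p) (-coeffF X p) (by linear_combination h0) (by ring)
  have h2 := key (-coeffF X p) (coeffE X p) (by ring) (by linear_combination h0)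
  have h3 := key 1 0 (by rw [h2.2]; ring) (by linear_combination -h2.1)
  exact one_ne_zero h3.1

/-- A plane on which the Lorentzian metric has positive determinant is positive definite: a
negative definite plane would violate the reversed Cauchy-Schwarz inequality. -/
theorem lprod_self_pos_of_gram_pos {u v : L3}
    (h : 0 < lprod u u * lprod v v - lprod u v ^ 2) : 0 < lprod u u := by
  by_contra hE
  push Not at hE
  have hE0 : lprod u u ≠ 0 := by
    intro h0
    rw [h0] at h
    nlinarith [sq_nonneg (lprod u v)]
  have hE' : lprod u u < 0 := lt_of_le_of_ne hE hE0
  have hu : 0 < u 2 ^ 2 := by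
    simp only [lprod] at hE'
    nlinarith [sq_nonneg (u 0), sq_nonneg (u 1)]
  -- the vector `u₂ v - v₂ u` is horizontal, hence spacelike
  have hy : 0 ≤ u 2 ^ 2 * lprod v v - 2 * u 2 * v 2 * lprod u v + v 2 ^ 2 * lprod u u := by
    have : u 2 ^ 2 * lprod v v - 2 * u 2 * v 2 * lprod u v + v 2 ^ 2 * lprod u u
        = (u 2 * v 0 - v 2 * u 0) ^ 2 + (u 2 * v 1 - v 2 * u 1) ^ 2 := by
      simp only [lprod]; ring
    rw [this]; positivity
  have h1 : lprod u u * (u 2 ^ 2 * lprod v v - 2 * u 2 * v 2 * lprod u v + v 2 ^ 2 * lprod u u)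
      = u 2 ^ 2 * (lprod u u * lprod v v - lprod u v ^ 2)
        + (u 2 * lprod u v - v 2 * lprod u u) ^ 2 := by ring
  have h2 := mul_nonpos_of_nonpos_of_nonneg hE'.le hy
  have h3 := mul_pos hu h
  nlinarith [sq_nonneg (u 2 * lprod u v - v 2 * lprod u u)]

theorem isSpacelikeAt_of_gramDet_pos {X : ℝ × ℝ → L3} {p : ℝ × ℝ} (h : 0 < gramDet X p) :
    IsSpacelikeAt X p := by
  intro w hw
  have hE : 0 < coeffE X p := lprod_self_pos_of_gram_pos h
  rw [firstForm_eq]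
  unfold gramDet at h
  have h1 : coeffE X p * (w.1 * w.1 * coeffE X p + (w.1 * w.2 + w.2 * w.1) * coeffF X p
      + w.2 * w.2 * coeffG X p) = (coeffE X p * w.1 + coeffF X p * w.2) ^ 2
        + (coeffE X p * coeffG X p - coeffF X p ^ 2) * w.2 ^ 2 := by ring
  refine pos_of_mul_pos_right (a := coeffE X p) ?_ hE.le
  rw [h1]
  by_cases h2 : w.2 = 0
  · have h3 : w.1 ≠ 0 := fun h3 => hw (Prod.ext h3 h2)
    rw [h2]
    have : 0 < (coeffE X p * w.1) ^ 2 := by positivity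
    linarith
  · have : 0 < w.2 ^ 2 := by positivity
    have := mul_pos h this
    positivity

theorem not_isSpacelikeAt_of_gramDet_neg {X : ℝ × ℝ → L3} {p : ℝ × ℝ} (h : gramDet X p < 0) :
    ¬ IsSpacelikeAt X p := by
  intro hs
  unfold gramDet at h
  have hE := hs (1, 0) (by simp)
  rw [firstForm_eq] at hE
  have hE' : 0 < coeffE X p := by simpa using hE
  have h1 := hs (-coeffF X p, coeffE X p) (by simp [hE'.ne'])
  rw [firstForm_eq] at h1
  simp only at h1
  nlinarith [mul_neg_of_pos_of_neg hE' h]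

/-- The Gauss equation in determinantal form. The two possible causal characters give the same
formula, since the sign `ε` is opposite to the sign of `E G - F²`. -/
theorem gaussK_mul_gramDet_sq {X : ℝ × ℝ → L3} {p : ℝ × ℝ} (h : gramDet X p ≠ 0) :
    gaussK X p * gramDet X p ^ 2 =
      lprod (lcross (dS X p) (dT X p)) (dT (dS X) p) ^ 2 -
      lprod (lcross (dS X p) (dT X p)) (dS (dS X) p) *
        lprod (lcross (dS X p) (dT X p)) (dT (dT X) p) := by
  have hN : lprod (lcross (dS X p) (dT X p)) (lcross (dS X p) (dT X p)) = -gramDet X p :=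
    lprod_lcross_self _ _
  have hsm : ∀ (c : ℝ) (u v : L3), lprod (c • u) v = c * lprod u v := by
    intro c u v; simp only [lprod, Pi.smul_apply, smul_eq_mul]; ring
  have hr : (Real.sqrt |gramDet X p|)⁻¹ ^ 2 = |gramDet X p|⁻¹ := by
    rw [inv_pow, Real.sq_sqrt (abs_nonneg _)]
  have hKdef : gaussK X p = causalSign X p * (((coeffL X p) * (coeffN X p) - (coeffM X p) ^ 2)
    / gramDet X p) := rfl
  have hq : coeffL X p * coeffN X p - coeffM X p ^ 2 = |gramDet X p|⁻¹ *
      (lprod (lcross (dS X p) (dT X p)) (dS (dS X) p) *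
        lprod (lcross (dS X p) (dT X p)) (dT (dT X) p) -
        lprod (lcross (dS X p) (dT X p)) (dT (dS X) p) ^ 2) := by
    rw [← hr]
    simp only [coeffL, coeffM, coeffN, unitNormal, hN, abs_neg, hsm]
    ring
  rw [hKdef, hq]
  rcases lt_or_gt_of_ne h with h1 | h1
  · have : causalSign X p = 1 := if_neg (not_isSpacelikeAt_of_gramDet_neg h1)
    rw [this, abs_of_neg h1]
    field_simp
    ring
  · have : causalSign X p = -1 := if_pos (isSpacelikeAt_of_gramDet_pos h1)
    rw [this, abs_of_pos h1]
    field_simp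
    ring

/-! ### Partial derivatives of `a(s) + b(t) + f(s) g(t) w` -/

theorem dS_eq_of_hasFDerivAt {X : ℝ × ℝ → L3} {p : ℝ × ℝ} {u v : L3}
    (h : HasFDerivAt X ((ContinuousLinearMap.fst ℝ ℝ ℝ).smulRight u +
      (ContinuousLinearMap.snd ℝ ℝ ℝ).smulRight v) p) : dS X p = u ∧ dT X p = v := by
  constructor
  · simp [dS, h.fderiv]
  · simp [dT, h.fderiv]

theorem hasFDerivAt_separated {a b : ℝ → L3} {f g : ℝ → ℝ} {p : ℝ × ℝ} (w : L3)
    (ha : DifferentiableAt ℝ a p.1) (hb : DifferentiableAt ℝ b p.2)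
    (hf : DifferentiableAt ℝ f p.1) (hg : DifferentiableAt ℝ g p.2) :
    HasFDerivAt (fun q : ℝ × ℝ => a q.1 + b q.2 + (f q.1 * g q.2) • w)
      ((ContinuousLinearMap.fst ℝ ℝ ℝ).smulRight (deriv a p.1 + (deriv f p.1 * g p.2) • w) +
      (ContinuousLinearMap.snd ℝ ℝ ℝ).smulRight (deriv b p.2 + (f p.1 * deriv g p.2) • w)) p := by
  have h1 : HasFDerivAt (fun q : ℝ × ℝ => a q.1) _ p :=
    ha.hasDerivAt.hasFDerivAt.comp p hasFDerivAt_fst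
  have h2 : HasFDerivAt (fun q : ℝ × ℝ => b q.2) _ p :=
    hb.hasDerivAt.hasFDerivAt.comp p hasFDerivAt_snd
  have h3 : HasFDerivAt (fun q : ℝ × ℝ => f q.1) _ p :=
    hf.hasDerivAt.hasFDerivAt.comp p hasFDerivAt_fst
  have h4 : HasFDerivAt (fun q : ℝ × ℝ => g q.2) _ p :=
    hg.hasDerivAt.hasFDerivAt.comp p hasFDerivAt_snd
  refine ((h1.add h2).add ((h3.mul h4).smul_const w)).congr_fderiv ?_
  apply ContinuousLinearMap.ext
  rintro ⟨x, y⟩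
  ext i
  simp
  ring

theorem smooth_deriv_and_differentiableAt {E : Type*} [NormedAddCommGroup E] [NormedSpace ℝ E]
    {I : Set ℝ} (hI : IsOpen I) {a : ℝ → E} (ha : ContDiffOn ℝ ∞ a I) :
    ContDiffOn ℝ ∞ (deriv a) I ∧ ∀ s ∈ I, DifferentiableAt ℝ a s := by
  constructor
  · exact ((contDiffOn_infty_iff_deriv_of_isOpen hI).1 ha).2
  · exact fun s hs => ((contDiffOn_infty_iff_deriv_of_isOpen hI).1 ha).1.differentiableAt
      (hI.mem_nhds hs)

/-- The first and second partial derivatives of a surface `a(s) + b(t) + f(s) g(t) w`: this covers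
both translation surfaces and graphs of products. -/
theorem partials_separated {I J : Set ℝ} (hI : IsOpen I) (hJ : IsOpen J) {a b : ℝ → L3}
    {f g : ℝ → ℝ} (w : L3) (ha : ContDiffOn ℝ ∞ a I) (hb : ContDiffOn ℝ ∞ b J)
    (hf : ContDiffOn ℝ ∞ f I) (hg : ContDiffOn ℝ ∞ g J) {X : ℝ × ℝ → L3}
    (hX : X = fun q : ℝ × ℝ => a q.1 + b q.2 + (f q.1 * g q.2) • w) {s t : ℝ}
    (hs : s ∈ I) (ht : t ∈ J) :
    dS X (s, t) = deriv a s + (deriv f s * g t) • w ∧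
    dT X (s, t) = deriv b t + (f s * deriv g t) • w ∧
    dS (dS X) (s, t) = deriv (deriv a) s + (deriv (deriv f) s * g t) • w ∧
    dT (dS X) (s, t) = (deriv f s * deriv g t) • w ∧
    dT (dT X) (s, t) = deriv (deriv b) t + (f s * deriv (deriv g) t) • w := by
  obtain ⟨ha1, ha0⟩ := smooth_deriv_and_differentiableAt hI ha
  obtain ⟨hb1, hb0⟩ := smooth_deriv_and_differentiableAt hJ hb
  obtain ⟨hf1, hf0⟩ := smooth_deriv_and_differentiableAt hI hf
  obtain ⟨hg1, hg0⟩ := smooth_deriv_and_differentiableAt hJ hg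
  have ha2 := (smooth_deriv_and_differentiableAt hI ha1).2
  have hb2 := (smooth_deriv_and_differentiableAt hJ hb1).2
  have hf2 := (smooth_deriv_and_differentiableAt hI hf1).2
  have hg2 := (smooth_deriv_and_differentiableAt hJ hg1).2
  have h1 : ∀ q ∈ I ×ˢ J, dS X q = deriv a q.1 + (deriv f q.1 * g q.2) • w ∧
      dT X q = deriv b q.2 + (f q.1 * deriv g q.2) • w := by
    intro q hq
    subst hX
    exact dS_eq_of_hasFDerivAt (hasFDerivAt_separated w (ha0 _ hq.1) (hb0 _ hq.2)
      (hf0 _ hq.1) (hg0 _ hq.2))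
  have hmem : (s, t) ∈ I ×ˢ J := ⟨hs, ht⟩
  have hnhds : I ×ˢ J ∈ nhds (s, t) := (hI.prod hJ).mem_nhds hmem
  have hz : DifferentiableAt ℝ (fun _ : ℝ => (0 : L3)) t := differentiableAt_const _
  have hz' : DifferentiableAt ℝ (fun _ : ℝ => (0 : L3)) s := differentiableAt_const _
  have e2 : dS X =ᶠ[nhds (s, t)] fun q => deriv a q.1 + 0 + (deriv f q.1 * g q.2) • w := by
    filter_upwards [hnhds] with q hq
    rw [(h1 q hq).1, add_zero]
  have e3 : dT X =ᶠ[nhds (s, t)] fun q => 0 + deriv b q.2 + (f q.1 * deriv g q.2) • w := by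
    filter_upwards [hnhds] with q hq
    rw [(h1 q hq).2, zero_add]
  have h2 := dS_eq_of_hasFDerivAt ((hasFDerivAt_separated (p := (s, t)) w (ha2 s hs) hz (hf2 s hs)
    (hg0 t ht)).congr_of_eventuallyEq e2)
  have h3 := dS_eq_of_hasFDerivAt ((hasFDerivAt_separated (p := (s, t)) w hz' (hb2 t ht) (hf0 s hs)
    (hg2 t ht)).congr_of_eventuallyEq e3)
  refine ⟨(h1 _ hmem).1, (h1 _ hmem).2, h2.1, ?_, h3.2⟩
  simpa using h2.2

/-! ### Recognizing cylindrical surfaces -/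

theorem eq_zero_of_fderiv_apply_eq_zero {U : Set (ℝ × ℝ)} {X : ℝ × ℝ → L3}
    (h : IsNondegenerateOn U X) {p : ℝ × ℝ} (hp : p ∈ U) {w : ℝ × ℝ}
    (hw : fderiv ℝ X p w = 0) : w = 0 :=
  h p hp w fun w' => by simp [firstForm, hw, lprod]

/-- If `X = γ ∘ ψ₁ + ψ₂ v` for a smooth map `ψ = (ψ₁, ψ₂)` of the parameter domain, then `X` is
cylindrical: `X` being an immersion, `ψ` is one too, and its local inverses are the required
changes of parameters. -/
theorem isCylindricalAlong_of_eq {U : Set (ℝ × ℝ)} (hU : IsOpen U) {X : ℝ × ℝ → L3}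
    (hX : IsNondegenerateOn U X) {v : L3} {P : Set L3} {V : Set ℝ} (hV : IsOpen V) {γ : ℝ → L3}
    (hγ : ContDiffOn ℝ ∞ γ V) (hγP : ∀ u ∈ V, γ u ∈ P) {ψ : ℝ × ℝ → ℝ × ℝ}
    (hψ : ContDiffOn ℝ ∞ ψ U) (hψV : ∀ q ∈ U, (ψ q).1 ∈ V)
    (h : ∀ q ∈ U, X q = γ (ψ q).1 + (ψ q).2 • v) : IsCylindricalAlong U X v P := by
  have hat : ∀ q ∈ U, ContDiffAt ℝ ∞ ψ q := fun q hq => hψ.contDiffAt (hU.mem_nhds hq)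
  have hequiv : ∀ q ∈ U, ∃ A : (ℝ × ℝ) ≃L[ℝ] (ℝ × ℝ),
      HasFDerivAt ψ (A : (ℝ × ℝ) →L[ℝ] (ℝ × ℝ)) q := by
    intro q hq
    have hd : HasFDerivAt ψ (fderiv ℝ ψ q) q :=
      ((hat q hq).differentiableAt (by simp)).hasFDerivAt
    have hg : HasFDerivAt γ (fderiv ℝ γ (ψ q).1) (ψ q).1 :=
      ((hγ.contDiffAt (hV.mem_nhds (hψV q hq))).differentiableAt (by simp)).hasFDerivAt
    have hd1 : HasFDerivAt (fun x => (ψ x).1) _ q := hasFDerivAt_fst.comp q hd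
    have hd2 : HasFDerivAt (fun x => (ψ x).2) _ q := hasFDerivAt_snd.comp q hd
    have hXd0 : HasFDerivAt (fun x => γ (ψ x).1 + (ψ x).2 • v) _ q :=
      (HasFDerivAt.comp (g := γ) q hg hd1).add (hd2.smul_const v)
    have hXe : X =ᶠ[nhds q] fun x => γ (ψ x).1 + (ψ x).2 • v := by
      filter_upwards [hU.mem_nhds hq] with x hx using h x hx
    have hXd := hXd0.congr_of_eventuallyEq hXe
    have hinj : Function.Injective (fderiv ℝ ψ q).toLinearMap := by
      rw [← LinearMap.ker_eq_bot, LinearMap.ker_eq_bot']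
      intro w hw
      apply eq_zero_of_fderiv_apply_eq_zero hX hq
      have hw' : fderiv ℝ ψ q w = 0 := hw
      rw [hXd.fderiv]
      simp [hw']
    refine ⟨(LinearEquiv.ofInjectiveEndo _ hinj).toContinuousLinearEquiv, ?_⟩
    convert hd using 1
    ext <;> simp
  intro p hp
  obtain ⟨A, hA⟩ := hequiv p hp
  let e := ((hat p hp).toOpenPartialHomeomorph ψ hA (by simp)).restrOpen U hU
  have hpe : p ∈ e.source := ⟨ContDiffAt.mem_toOpenPartialHomeomorph_source _ hA _, hp⟩
  have hesub : e.source ⊆ U := fun x hx => hx.2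
  have he : ∀ x, e x = ψ x := fun x => rfl
  have ht : e.target ∈ nhds (ψ p) := e.open_target.mem_nhds (e.map_source hpe)
  obtain ⟨V1, hV1, V2, hV2, hsub⟩ := mem_nhds_prod_iff.1 ht
  obtain ⟨a, b, hab, hab'⟩ := mem_nhds_iff_exists_Ioo_subset.1 hV1
  obtain ⟨c, d, hcd, hcd'⟩ := mem_nhds_iff_exists_Ioo_subset.1 hV2
  have hbox : Ioo a b ×ˢ Ioo c d ⊆ e.target := (prod_mono hab' hcd').trans hsub
  let φ := e.symm.restrOpen (Ioo a b ×ˢ Ioo c d) (isOpen_Ioo.prod isOpen_Ioo)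
  have hsource : φ.source = Ioo a b ×ˢ Ioo c d := inter_eq_self_of_subset_right hbox
  have htarget : φ.target ⊆ e.source := by
    intro x hx
    have h1 := φ.map_target hx
    have h2 : φ (φ.symm x) = x := φ.right_inv hx
    rw [← h2]
    exact e.symm.map_source h1.1
  have hφψ : ∀ y ∈ Ioo a b ×ˢ Ioo c d, φ y ∈ U ∧ ψ (φ y) = y := fun y hy =>
    ⟨hesub (e.map_target (hbox hy)), e.right_inv (hbox hy)⟩
  refine ⟨φ, a, b, c, d, γ, hsource, ?_, htarget.trans hesub, ?_, ?_, ?_, ?_, ?_⟩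
  · have h1 : ψ p ∈ φ.source := by rw [hsource]; exact ⟨hab, hcd⟩
    have h2 : φ (ψ p) = p := e.left_inv hpe
    have h3 := φ.map_source h1
    rwa [h2] at h3
  · rw [hsource]
    intro y hy
    obtain ⟨A', hA'⟩ := hequiv _ (hφψ y hy).1
    exact (e.contDiffAt_symm (hbox hy) (f₀' := A') hA' (hat _ (hφψ y hy).1)).contDiffWithinAt
  · exact hψ.mono (htarget.trans hesub)
  · refine hγ.mono fun u hu => ?_
    obtain ⟨w, hw⟩ : (Ioo c d).Nonempty := ⟨_, hcd⟩
    have h1 := hφψ (u, w) ⟨hu, hw⟩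
    have h2 := hψV _ h1.1
    rwa [h1.2] at h2
  · intro u hu
    obtain ⟨w, hw⟩ : (Ioo c d).Nonempty := ⟨_, hcd⟩
    have h1 := hφψ (u, w) ⟨hu, hw⟩
    have h2 := hψV _ h1.1
    rw [h1.2] at h2
    exact hγP u h2
  · intro u hu w hw
    have h1 := hφψ (u, w) ⟨hu, hw⟩
    rw [h _ h1.1, h1.2]

/-! ### Linear algebra of the Lorentzian product -/

theorem eq_zero_of_lprod_eq_zero {u v w x : L3} (h : lprod (lcross u v) w ≠ 0)
    (hu : lprod x u = 0) (hv : lprod x v = 0) (hw : lprod x w = 0) : x = 0 := by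
  have key : ∀ i, lprod (lcross u v) w * x i = 0 := by
    simp only [lprod] at hu hv hw
    intro i
    fin_cases i
    · simp [-mul_eq_zero, lprod, lcross]
      linear_combination (v 1 * w 2 - v 2 * w 1) * hu + (w 1 * u 2 - w 2 * u 1) * hv +
        (u 1 * v 2 - u 2 * v 1) * hw
    · simp [-mul_eq_zero, lprod, lcross]
      linear_combination (v 2 * w 0 - v 0 * w 2) * hu + (w 2 * u 0 - w 0 * u 2) * hv +
        (u 2 * v 0 - u 0 * v 2) * hw
    · simp [-mul_eq_zero, lprod, lcross]
      linear_combination -(v 0 * w 1 - v 1 * w 0) * hu - (w 0 * u 1 - w 1 * u 0) * hv -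
        (u 0 * v 1 - u 1 * v 0) * hw
  funext i
  exact (mul_eq_zero.1 (key i)).resolve_left h

theorem sum_sq_pos {v : L3} (hv : v ≠ 0) : 0 < v 0 ^ 2 + v 1 ^ 2 + v 2 ^ 2 := by
  by_contra h
  have h0 := sq_nonneg (v 0)
  have h1 := sq_nonneg (v 1)
  have h2 := sq_nonneg (v 2)
  have e0 : v 0 = 0 := (pow_eq_zero_iff two_ne_zero).1 (by linarith)
  have e1 : v 1 = 0 := (pow_eq_zero_iff two_ne_zero).1 (by linarith)
  have e2 : v 2 = 0 := (pow_eq_zero_iff two_ne_zero).1 (by linarith)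
  apply hv
  funext i
  fin_cases i <;> assumption

/-- The coordinate along `v`, defined by Euclidean orthogonal projection. -/
noncomputable def coordAlong (v x : L3) : ℝ :=
  (v 0 * x 0 + v 1 * x 1 + v 2 * x 2) / (v 0 ^ 2 + v 1 ^ 2 + v 2 ^ 2)

theorem eq_coordAlong_smul {v x : L3} (hv : v ≠ 0) (h : lcross v x = 0) :
    x = coordAlong v x • v := by
  have hn := (sum_sq_pos hv).ne'
  have h0 : v 1 * x 2 - v 2 * x 1 = 0 := congrFun h 0
  have h1 : v 2 * x 0 - v 0 * x 2 = 0 := congrFun h 1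
  have h2 : v 1 * x 0 - v 0 * x 1 = 0 := congrFun h 2
  funext i
  simp only [coordAlong, Pi.smul_apply, smul_eq_mul]
  rw [div_mul_eq_mul_div, eq_div_iff hn]
  fin_cases i
  · simp only [Fin.zero_eta]; linear_combination v 1 * h2 + v 2 * h1
  · simp only [Fin.mk_one]; linear_combination -v 0 * h2 - v 2 * h0
  · simp only [Fin.reduceFinMk]; linear_combination -v 0 * h1 + v 1 * h0

theorem lcross_lcross_eq_zero {x u v : L3} (hu : lprod x u = 0) (hv : lprod x v = 0) :
    lcross (lcross u v) x = 0 := by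
  simp only [lprod] at hu hv
  funext i
  fin_cases i
  · simp [lcross]; linear_combination u 0 * hv - v 0 * hu
  · simp [lcross]; linear_combination u 1 * hv - v 1 * hu
  · simp [lcross]; linear_combination u 2 * hv - v 2 * hu

theorem lprod_smul_left (c : ℝ) (u v : L3) : lprod (c • u) v = c * lprod u v := by
  simp only [lprod, Pi.smul_apply, smul_eq_mul]; ring

theorem eq_zero_of_forall_lprod {x : L3} (h : ∀ e, lprod x e = 0) : x = 0 := by
  have h0 := h ![1, 0, 0]
  have h1 := h ![0, 1, 0]
  have h2 := h ![0, 0, 1]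
  simp [lprod] at h0 h1 h2
  funext i
  fin_cases i <;> assumption

/-! ### Curves in planes and lines -/

theorem hasDerivAt_lprod (ν : L3) {a : ℝ → L3} {s : ℝ} (h : DifferentiableAt ℝ a s) :
    HasDerivAt (fun x => lprod ν (a x)) (lprod ν (deriv a s)) s := by
  have h1 := hasDerivAt_pi.1 h.hasDerivAt
  exact (((h1 0).const_mul (ν 0)).add ((h1 1).const_mul (ν 1))).sub ((h1 2).const_mul (ν 2))

/-- A nowhere zero vector function which, at each point, lies in the plane `⟨ν, ·⟩ = 0` or is
collinear with its derivative stays in that plane once it meets it: the square of `⟨ν, a⟩` over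
the Euclidean norm of `a` is constant. -/
theorem lprod_eq_zero_of_collinear {I : Set ℝ} (hI : IsOpen I) (hc : I.OrdConnected)
    {a : ℝ → L3} (ha : ∀ s ∈ I, DifferentiableAt ℝ a s) (ha0 : ∀ s ∈ I, a s ≠ 0) {ν : L3}
    (h : ∀ s ∈ I, lcross (a s) (deriv a s) = 0 ∨ lprod ν (a s) = 0) {s₀ : ℝ} (hs₀ : s₀ ∈ I)
    (h0 : lprod ν (a s₀) = 0) : ∀ s ∈ I, lprod ν (a s) = 0 := by
  set q : ℝ → ℝ := fun s => lprod ν (a s) ^ 2 / (a s 0 ^ 2 + a s 1 ^ 2 + a s 2 ^ 2) with hq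
  have hd : ∀ s ∈ I, HasDerivAt q 0 s := by
    intro s hs
    have h1 := hasDerivAt_pi.1 (ha s hs).hasDerivAt
    have hn := (sum_sq_pos (ha0 s hs)).ne'
    have h2 := ((hasDerivAt_lprod ν (ha s hs)).pow 2).div
      ((((h1 0).pow 2).add ((h1 1).pow 2)).add ((h1 2).pow 2)) hn
    convert! h2 using 1
    symm
    simp only [Pi.add_apply, Pi.pow_apply]
    rw [div_eq_zero_iff]
    left
    rcases h s hs with h3 | h3
    · have e0 : a s 1 * deriv a s 2 - a s 2 * deriv a s 1 = 0 := congrFun h3 0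
      have e1 : a s 2 * deriv a s 0 - a s 0 * deriv a s 2 = 0 := congrFun h3 1
      have e2 : a s 1 * deriv a s 0 - a s 0 * deriv a s 1 = 0 := congrFun h3 2
      simp only [lprod]
      push_cast
      set c := ν 0 * a s 0 + ν 1 * a s 1 - ν 2 * a s 2
      linear_combination 2 * c * (ν 0 * (a s 1 * e2 + a s 2 * e1) +
        ν 1 * (-a s 0 * e2 - a s 2 * e0) - ν 2 * (-a s 0 * e1 + a s 1 * e0))
    · rw [h3]; ring
  intro s hs
  have h1 : q s = q s₀ := hI.is_const_of_deriv_eq_zero hc.isPreconnected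
    (fun x hx => (hd x hx).differentiableAt.differentiableWithinAt) (fun x hx => (hd x hx).deriv)
    hs hs₀
  simp only [hq, h0] at h1
  rw [div_eq_iff (sum_sq_pos (ha0 s hs)).ne'] at h1
  simpa using h1

theorem lprod_eq_const {I : Set ℝ} (hI : IsOpen I) (hc : I.OrdConnected) {α : ℝ → L3}
    (hα : ∀ s ∈ I, DifferentiableAt ℝ α s) {ν : L3}
    (h : ∀ s ∈ I, lprod ν (deriv α s) = 0) {s s₀ : ℝ} (hs : s ∈ I) (hs₀ : s₀ ∈ I) :
    lprod ν (α s) = lprod ν (α s₀) :=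
  hI.is_const_of_deriv_eq_zero (f := fun x => lprod ν (α x)) hc.isPreconnected
    (fun x hx => (hasDerivAt_lprod ν (hα x hx)).differentiableAt.differentiableWithinAt)
    (fun x hx => by rw [(hasDerivAt_lprod ν (hα x hx)).deriv]; exact h x hx) hs hs₀

theorem contDiffOn_coordAlong {I : Set ℝ} {α : ℝ → L3} (hα : ContDiffOn ℝ ∞ α I) (v : L3) :
    ContDiffOn ℝ ∞ (fun s => coordAlong v (α s)) I := by
  have h := contDiffOn_pi.1 hα
  unfold coordAlong
  exact (((contDiffOn_const.mul (h 0)).add (contDiffOn_const.mul (h 1))).add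
    (contDiffOn_const.mul (h 2))).div_const _

/-- A regular curve whose acceleration is always collinear with its velocity lies on a line. -/
theorem exists_eq_add_smul_of_collinear {I : Set ℝ} (hI : IsOpen I) (hc : I.OrdConnected)
    (hne : I.Nonempty) {α : ℝ → L3} (hα : ContDiffOn ℝ ∞ α I) (h0 : ∀ s ∈ I, deriv α s ≠ 0)
    (h : ∀ s ∈ I, lcross (deriv α s) (deriv (deriv α) s) = 0) :
    ∃ (x v : L3) (c : ℝ → ℝ), v ≠ 0 ∧ ContDiffOn ℝ ∞ c I ∧ ∀ s ∈ I, α s = x + c s • v := by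
  obtain ⟨hα1, hα0⟩ := smooth_deriv_and_differentiableAt hI hα
  have hα2 := (smooth_deriv_and_differentiableAt hI hα1).2
  obtain ⟨s₀, hs₀⟩ := hne
  refine ⟨α s₀, deriv α s₀, fun s => coordAlong (deriv α s₀) (α s - α s₀), h0 s₀ hs₀,
    contDiffOn_coordAlong (hα.sub contDiffOn_const) _, ?_⟩
  intro s hs
  rw [← eq_coordAlong_smul (h0 s₀ hs₀)]
  · simp
  · apply eq_zero_of_forall_lprod
    intro e
    have hsw : ∀ x, lprod (lcross (deriv α s₀) e) x = -lprod (lcross (deriv α s₀) x) e := by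
      intro x; simp [lprod, lcross]; ring
    have h1 := lprod_eq_zero_of_collinear hI hc hα2 h0 (ν := lcross (deriv α s₀) e)
      (fun s hs => Or.inl (h s hs)) hs₀ (by simp [lprod, lcross]; ring)
    have h2 := lprod_eq_const hI hc hα0 h1 hs hs₀
    have h3 : lprod (lcross (deriv α s₀) e) (α s - α s₀) = 0 := by
      have : lprod (lcross (deriv α s₀) e) (α s - α s₀) =
        lprod (lcross (deriv α s₀) e) (α s) - lprod (lcross (deriv α s₀) e) (α s₀) := by
        simp only [lprod, Pi.sub_apply]; ring
      rw [this, h2, sub_self]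
    rw [hsw] at h3
    exact neg_eq_zero.1 h3

/-! ### Flat translation surfaces -/

/-- The partial derivatives of a translation surface. -/
theorem IsTranslationSurface.partials {I J : Set ℝ} {α β : ℝ → L3} {X : ℝ × ℝ → L3}
    (h : IsTranslationSurface I J α β X) {s t : ℝ} (hs : s ∈ I) (ht : t ∈ J) :
    dS X (s, t) = deriv α s ∧ dT X (s, t) = deriv β t ∧ dS (dS X) (s, t) = deriv (deriv α) s ∧
    dT (dS X) (s, t) = 0 ∧ dT (dT X) (s, t) = deriv (deriv β) t := by
  have h1 := partials_separated h.interval_left.1 h.interval_right.1 (f := fun _ => 0)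
    (g := fun _ => 0) 0 h.smooth_left h.smooth_right contDiffOn_const contDiffOn_const
    (X := X) (by rw [h.eq_sum]; simp) hs ht
  simpa using h1

/-- The Gauss equation of a translation surface. -/
theorem IsTranslationSurface.gauss {I J : Set ℝ} {α β : ℝ → L3} {X : ℝ × ℝ → L3}
    (h : IsTranslationSurface I J α β X) (hX : IsNondegenerateOn (I ×ˢ J) X) {s t : ℝ}
    (hs : s ∈ I) (ht : t ∈ J) :
    lprod (deriv α s) (deriv α s) * lprod (deriv β t) (deriv β t) -
      lprod (deriv α s) (deriv β t) ^ 2 ≠ 0 ∧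
    gaussK X (s, t) * (lprod (deriv α s) (deriv α s) * lprod (deriv β t) (deriv β t) -
      lprod (deriv α s) (deriv β t) ^ 2) ^ 2 =
    -(lprod (lcross (deriv α s) (deriv β t)) (deriv (deriv α) s) *
      lprod (lcross (deriv α s) (deriv β t)) (deriv (deriv β) t)) := by
  obtain ⟨h1, h2, h3, h4, h5⟩ := h.partials hs ht
  have hW := gramDet_ne_zero hX (p := (s, t)) ⟨hs, ht⟩
  have hK := gaussK_mul_gramDet_sq hW
  simp only [gramDet, coeffE, coeffF, coeffG, h1, h2, h3, h4, h5] at hW hK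
  refine ⟨hW, hK.trans ?_⟩
  simp [lprod]

theorem lprod_lcross_swap (u v w : L3) : lprod (lcross v u) w = -lprod (lcross u v) w := by
  simp [lprod, lcross]; ring

/-- If, for all `s` and `t`, the velocities `a(s)`, `b(t)` are coplanar with `a'(s)` or with
`b'(t)`, and the first alternative fails at `(s₁, t₁)`, then `b` and `b'` are collinear at `t₁`. -/
theorem lcross_deriv_eq_zero {I J : Set ℝ} (hI : IsOpen I) {a b : ℝ → L3}
    (ha : ContDiffOn ℝ ∞ a I)
    (h : ∀ s ∈ I, ∀ t ∈ J, lprod (lcross (a s) (b t)) (deriv a s) = 0 ∨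
      lprod (lcross (a s) (b t)) (deriv b t) = 0) {s₁ t₁ : ℝ} (hs : s₁ ∈ I) (ht : t₁ ∈ J)
    (h1 : lprod (lcross (a s₁) (b t₁)) (deriv a s₁) ≠ 0) : lcross (b t₁) (deriv b t₁) = 0 := by
  obtain ⟨ha1, ha0⟩ := smooth_deriv_and_differentiableAt hI ha
  have ha2 := (smooth_deriv_and_differentiableAt hI ha1).2
  have hcont : ContinuousAt (fun s => lprod (lcross (a s) (b t₁)) (deriv a s)) s₁ := by
    have c1 := continuousAt_pi.1 (ha0 s₁ hs).continuousAt
    have c2 := continuousAt_pi.1 (ha2 s₁ hs).continuousAt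
    have c10 := c1 0
    have c11 := c1 1
    have c12 := c1 2
    have c20 := c2 0
    have c21 := c2 1
    have c22 := c2 2
    simp only [lprod, lcross, Matrix.cons_val_zero, Matrix.cons_val_one, Matrix.cons_val]
    fun_prop
  have hev := hcont.eventually_ne h1
  have hcyc : ∀ x, lprod (lcross (b t₁) (deriv b t₁)) x = lprod (lcross x (b t₁)) (deriv b t₁) := by
    intro x; simp [lprod, lcross]; ring
  have hzero : (fun s => lprod (lcross (b t₁) (deriv b t₁)) (a s)) =ᶠ[nhds s₁] fun _ => 0 := by
    filter_upwards [hev, hI.mem_nhds hs] with s hs1 hs2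
    rw [hcyc]
    exact (h s hs2 t₁ ht).resolve_left hs1
  have hd := hasDerivAt_lprod (lcross (b t₁) (deriv b t₁)) (ha0 s₁ hs)
  have hd0 : lprod (lcross (b t₁) (deriv b t₁)) (deriv a s₁) = 0 :=
    hd.unique ((hasDerivAt_const s₁ (0 : ℝ)).congr_of_eventuallyEq hzero)
  exact eq_zero_of_lprod_eq_zero h1 hzero.self_of_nhds (by simp [lprod, lcross]; ring) hd0

/-- An immersed surface contained in a plane is cylindrical. -/
theorem isCylindrical_of_planar {U : Set (ℝ × ℝ)} (hU : IsOpen U) {X : ℝ × ℝ → L3}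
    (hX : IsNondegenerateOn U X) (hs : ContDiffOn ℝ ∞ X U) {ν : L3} (hν : ν ≠ 0) {c : ℝ}
    (h : ∀ p ∈ U, lprod ν (X p) = c) : IsCylindrical U X := by
  have hc := contDiffOn_pi.1 hs
  have hk : ν 0 ≠ 0 ∨ ν 1 ≠ 0 ∨ ν 2 ≠ 0 := by
    by_contra hk
    push Not at hk
    apply hν
    funext i
    fin_cases i
    exacts [hk.1, hk.2.1, hk.2.2]
  simp only [lprod] at h
  -- the plane is a graph over the coordinate plane of two coordinates of `X`
  rcases hk with hk | hk | hk
  · refine ⟨![ν 2 / ν 0, 0, 1], fun h0 => by simpa using congrFun h0 2, ?_⟩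
    refine isCylindricalAlong_of_eq hU hX isOpen_univ (γ := fun u => ![(c - ν 1 * u) / ν 0, u, 0])
      ?_ (fun _ _ => mem_univ _) ((hc 1).prodMk (hc 2)) (fun _ _ => mem_univ _) ?_
    · refine contDiffOn_pi.2 fun i => ?_
      fin_cases i <;> simp <;> fun_prop
    · intro q hq
      have := h q hq
      funext i
      fin_cases i <;> simp
      field_simp
      linarith
  · refine ⟨![0, ν 2 / ν 1, 1], fun h0 => by simpa using congrFun h0 2, ?_⟩
    refine isCylindricalAlong_of_eq hU hX isOpen_univ (γ := fun u => ![u, (c - ν 0 * u) / ν 1, 0])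
      ?_ (fun _ _ => mem_univ _) ((hc 0).prodMk (hc 2)) (fun _ _ => mem_univ _) ?_
    · refine contDiffOn_pi.2 fun i => ?_
      fin_cases i <;> simp <;> fun_prop
    · intro q hq
      have := h q hq
      funext i
      fin_cases i <;> simp
      field_simp
      linarith
  · refine ⟨![0, 1, ν 1 / ν 2], fun h0 => by simpa using congrFun h0 1, ?_⟩
    refine isCylindricalAlong_of_eq hU hX isOpen_univ (γ := fun u => ![u, 0, (ν 0 * u - c) / ν 2])
      ?_ (fun _ _ => mem_univ _) ((hc 0).prodMk (hc 1)) (fun _ _ => mem_univ _) ?_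
    · refine contDiffOn_pi.2 fun i => ?_
      fin_cases i <;> simp <;> fun_prop
    · intro q hq
      have := h q hq
      funext i
      fin_cases i <;> simp
      field_simp
      linarith

/-- A flat translation surface is cylindrical. Either one of the curves is a line, or both curves
have points of non-zero curvature, and these force both curves into parallel planes. -/
theorem IsTranslationSurface.isCylindrical {I J : Set ℝ} {α β : ℝ → L3} {X : ℝ × ℝ → L3}
    (h : IsTranslationSurface I J α β X) (hX : IsNondegenerateOn (I ×ˢ J) X)
    (hK : ∀ p ∈ I ×ˢ J, gaussK X p = 0) : IsCylindrical (I ×ˢ J) X := by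
  obtain ⟨hI, hIc, hIn⟩ := h.interval_left
  obtain ⟨hJ, hJc, hJn⟩ := h.interval_right
  have hIn' := hIn
  have hJn' := hJn
  obtain ⟨i₀, hi₀⟩ := hIn'
  obtain ⟨j₀, hj₀⟩ := hJn'
  have hU : IsOpen (I ×ˢ J) := hI.prod hJ
  obtain ⟨hα1, hα0⟩ := smooth_deriv_and_differentiableAt hI h.smooth_left
  obtain ⟨hβ1, hβ0⟩ := smooth_deriv_and_differentiableAt hJ h.smooth_right
  have hα2 := (smooth_deriv_and_differentiableAt hI hα1).2
  have hβ2 := (smooth_deriv_and_differentiableAt hJ hβ1).2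
  have ha0 : ∀ s ∈ I, deriv α s ≠ 0 := by
    intro s hs h0
    apply (h.gauss hX hs hj₀).1
    simp [h0, lprod]
  have hb0 : ∀ t ∈ J, deriv β t ≠ 0 := by
    intro t ht h0
    apply (h.gauss hX hi₀ ht).1
    simp [h0, lprod]
  have hD : ∀ s ∈ I, ∀ t ∈ J, lprod (lcross (deriv α s) (deriv β t)) (deriv (deriv α) s) = 0 ∨
      lprod (lcross (deriv α s) (deriv β t)) (deriv (deriv β) t) = 0 := by
    intro s hs t ht
    have h1 := (h.gauss hX hs ht).2
    rw [hK _ ⟨hs, ht⟩, zero_mul] at h1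
    exact mul_eq_zero.1 (neg_eq_zero.1 h1.symm)
  have hfst : ContDiffOn ℝ ∞ (Prod.fst : ℝ × ℝ → ℝ) (I ×ˢ J) := contDiff_fst.contDiffOn
  have hsnd : ContDiffOn ℝ ∞ (Prod.snd : ℝ × ℝ → ℝ) (I ×ˢ J) := contDiff_snd.contDiffOn
  by_cases hA : ∀ s ∈ I, lcross (deriv α s) (deriv (deriv α) s) = 0
  · obtain ⟨x, v, c, hv, hc, hαc⟩ :=
      exists_eq_add_smul_of_collinear hI hIc hIn h.smooth_left ha0 hA
    refine ⟨v, hv, isCylindricalAlong_of_eq hU hX hJ (γ := fun t => x + β t)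
      (contDiffOn_const.add h.smooth_right) (fun _ _ => mem_univ _) (ψ := fun q => (q.2, c q.1))
      (hsnd.prodMk (hc.comp hfst fun q hq => hq.1)) (fun q hq => hq.2) ?_⟩
    intro q hq
    simp only [h.eq_sum, hαc q.1 hq.1]
    abel
  by_cases hB : ∀ t ∈ J, lcross (deriv β t) (deriv (deriv β) t) = 0
  · obtain ⟨x, v, c, hv, hc, hβc⟩ :=
      exists_eq_add_smul_of_collinear hJ hJc hJn h.smooth_right hb0 hB
    refine ⟨v, hv, isCylindricalAlong_of_eq hU hX hI (γ := fun s => α s + x)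
      (h.smooth_left.add contDiffOn_const) (fun _ _ => mem_univ _) (ψ := fun q => (q.1, c q.2))
      (hfst.prodMk (hc.comp hsnd fun q hq => hq.2)) (fun q hq => hq.1) ?_⟩
    intro q hq
    simp only [h.eq_sum, hβc q.2 hq.2]
    abel
  push Not at hA hB
  obtain ⟨s₀, hs₀, hA⟩ := hA
  obtain ⟨t₀, ht₀, hB⟩ := hB
  -- at points where both curves have non-zero curvature, both determinants vanish
  have hDa : ∀ s ∈ I, ∀ t ∈ J, lcross (deriv β t) (deriv (deriv β) t) ≠ 0 →
      lprod (lcross (deriv α s) (deriv (deriv α) s)) (deriv β t) = 0 := by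
    intro s hs t ht h1
    by_contra h2
    apply h1
    refine lcross_deriv_eq_zero hI hα1 hD hs ht fun h3 => h2 ?_
    rw [← neg_eq_zero, ← h3]
    simp [lprod, lcross]; ring
  have hDb : ∀ t ∈ J, ∀ s ∈ I, lcross (deriv α s) (deriv (deriv α) s) ≠ 0 →
      lprod (lcross (deriv β t) (deriv (deriv β) t)) (deriv α s) = 0 := by
    intro t ht s hs h1
    by_contra h2
    apply h1
    refine lcross_deriv_eq_zero (b := deriv α) hJ hβ1 (J := I) ?_ ht hs fun h3 => h2 ?_
    · intro t ht s hs
      simp only [lprod_lcross_swap (deriv α s) (deriv β t), neg_eq_zero]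
      exact (hD s hs t ht).symm
    · rw [← neg_eq_zero, ← h3]
      simp [lprod, lcross]; ring
  set ν := lcross (deriv α s₀) (deriv (deriv α) s₀) with hν
  have hνβ : ∀ t ∈ J, lprod ν (deriv β t) = 0 := by
    refine lprod_eq_zero_of_collinear hJ hJc hβ2 hb0 (fun t ht => ?_) ht₀ (hDa s₀ hs₀ t₀ ht₀ hB)
    by_cases h1 : lcross (deriv β t) (deriv (deriv β) t) = 0
    · exact Or.inl h1
    · exact Or.inr (hDa s₀ hs₀ t ht h1)
  have hνβ' : lprod ν (deriv (deriv β) t₀) = 0 := by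
    have h1 := hasDerivAt_lprod ν (hβ2 t₀ ht₀)
    refine h1.unique ((hasDerivAt_const t₀ (0 : ℝ)).congr_of_eventuallyEq ?_)
    filter_upwards [hJ.mem_nhds ht₀] with t ht using hνβ t ht
  have hνη := eq_coordAlong_smul hB (lcross_lcross_eq_zero (hνβ t₀ ht₀) hνβ')
  have hνα : ∀ s ∈ I, lprod ν (deriv α s) = 0 := by
    refine lprod_eq_zero_of_collinear hI hIc hα2 ha0 (fun s hs => ?_) hs₀
      (by rw [hν]; simp [lprod, lcross]; ring)
    by_cases h1 : lcross (deriv α s) (deriv (deriv α) s) = 0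
    · exact Or.inl h1
    · right
      rw [hνη, lprod_smul_left, hDb t₀ ht₀ s hs h1, mul_zero]
  refine isCylindrical_of_planar hU hX ?_ hA (c := lprod ν (α s₀) + lprod ν (β t₀)) ?_
  · rw [h.eq_sum]
    exact (h.smooth_left.comp hfst fun q hq => hq.1).add
      (h.smooth_right.comp hsnd fun q hq => hq.2)
  · intro p hp
    rw [← lprod_eq_const hI hIc hα0 hνα hp.1 hs₀, ← lprod_eq_const hJ hJc hβ0 hνβ hp.2 ht₀,
      h.eq_sum]
    simp only [lprod, Pi.add_apply]
    ring

/-! ### Translation surfaces with a planar curve -/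

theorem infinite_image_of_not_const {I : Set ℝ} (hc : I.OrdConnected) {f : ℝ → ℝ}
    (hf : ContinuousOn f I) {x y : ℝ} (hx : x ∈ I) (hy : y ∈ I) (hxy : f x ≠ f y) :
    (f '' I).Infinite :=
  (hc.isPreconnected.image f hf).infinite_of_nontrivial
    ⟨_, mem_image_of_mem f hx, _, mem_image_of_mem f hy, hxy⟩

/-- If `c q² = r² ℓ` holds at infinitely many points, for quadratic polynomials `q`, `r` and an
affine polynomial `ℓ`, then, by parity of the degree, `ℓ` is constant, and `q` is a multiple
of `r`. -/
theorem proportional_of_sq_mul_eq {c q0 q1 q2 r0 r1 r2 l0 l1 : ℝ} (hc : c ≠ 0) {T : Set ℝ}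
    (hT : T.Infinite) (h : ∀ x ∈ T, c * (q0 + q1 * x + q2 * x ^ 2) ^ 2 =
      (r0 + r1 * x + r2 * x ^ 2) ^ 2 * (l0 + l1 * x))
    {x₀ : ℝ} (hx₀ : x₀ ∈ T) (hr : r0 + r1 * x₀ + r2 * x₀ ^ 2 ≠ 0) :
    l1 = 0 ∧ ∃ k : ℝ, q0 = k * r0 ∧ q1 = k * r1 ∧ q2 = k * r2 := by
  classical
  set q : Polynomial ℝ := .C q0 + .C q1 * .X + .C q2 * .X ^ 2 with hq
  set r : Polynomial ℝ := .C r0 + .C r1 * .X + .C r2 * .X ^ 2 with hrdef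
  set l : Polynomial ℝ := .C l1 * .X + .C l0 with hl
  have hqr : .C c * q ^ 2 = r ^ 2 * l := by
    refine Polynomial.eq_of_infinite_eval_eq _ _ (hT.mono fun x hx => ?_)
    have := h x hx
    simp [hq, hrdef, hl]
    linarith
  have hr0 : r ≠ 0 := by
    intro h0
    apply hr
    have := congrArg (Polynomial.eval x₀) h0
    simpa [hrdef] using this
  have hl1 : l1 = 0 := by
    by_contra hl1
    have hdeg : l.natDegree = 1 := Polynomial.natDegree_linear hl1
    have hl0 : l ≠ 0 := by
      intro h0
      rw [h0] at hdeg
      simp at hdeg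
    have h1 := congrArg Polynomial.natDegree hqr
    rw [Polynomial.natDegree_C_mul hc, Polynomial.natDegree_pow,
      Polynomial.natDegree_mul (pow_ne_zero 2 hr0) hl0, Polynomial.natDegree_pow, hdeg] at h1
    omega
  refine ⟨hl1, ?_⟩
  have hnn : 0 ≤ l0 / c := by
    have h1 := h x₀ hx₀
    rw [hl1, zero_mul, add_zero] at h1
    have h2 : l0 / c = ((q0 + q1 * x₀ + q2 * x₀ ^ 2) / (r0 + r1 * x₀ + r2 * x₀ ^ 2)) ^ 2 := by
      rw [div_pow, div_eq_div_iff hc (pow_ne_zero 2 hr)]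
      linear_combination -h1
    rw [h2]
    positivity
  set k := Real.sqrt (l0 / c) with hk
  have hk2 : c * k ^ 2 = l0 := by
    rw [hk, Real.sq_sqrt hnn]
    field_simp
  have hprod : (q - .C k * r) * (q + .C k * r) = 0 := by
    have h1 : .C c * ((q - .C k * r) * (q + .C k * r)) = (0 : Polynomial ℝ) := by
      have h2 : l = .C c * .C k ^ 2 := by
        rw [hl, hl1, ← hk2]; simp
      rw [h2] at hqr
      linear_combination hqr
    exact (mul_eq_zero.1 h1).resolve_left (by simpa using hc)
  have hcoeff : ∀ k' : ℝ, q = .C k' * r → q0 = k' * r0 ∧ q1 = k' * r1 ∧ q2 = k' * r2 := by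
    intro k' h1
    refine ⟨?_, ?_, ?_⟩
    · simpa [hq, hrdef] using congrArg (fun p => Polynomial.coeff p 0) h1
    · simpa [hq, hrdef, Polynomial.coeff_X, Polynomial.coeff_C, Polynomial.coeff_X_pow] using
        congrArg (fun p => Polynomial.coeff p 1) h1
    · simpa [hq, hrdef, Polynomial.coeff_X, Polynomial.coeff_C, Polynomial.coeff_X_pow] using
        congrArg (fun p => Polynomial.coeff p 2) h1
  rcases mul_eq_zero.1 hprod with h1 | h1
  · exact ⟨k, hcoeff k (sub_eq_zero.1 h1)⟩
  · refine ⟨-k, hcoeff (-k) ?_⟩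
    rw [eq_neg_of_add_eq_zero_left h1]
    simp

/-- The Gram matrix with entries `E, F, u; F, G, v; u, v, w` of a basis `e, p, b` is singular if
the quadratic forms `⟨x, x⟩⟨b + μp, b + μp⟩ - ⟨x, b + μp⟩²` on the plane of `e` and `p` are
proportional to each other; here proportionality is expressed by minors of their
coefficients at `1`, `μ`, `μ²`. -/
theorem gram_eq_zero_of_minors {E F G u v w : ℝ}
    (h1 : (E * G - F ^ 2) * (F * w - u * v) = 0) (h2 : (E * G - F ^ 2) * (G * w - v ^ 2) = 0)
    (h3 : (F * v - u * G) * (G * w - v ^ 2) = 0)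
    (h4 : (E * v - u * F) * (G * w - v ^ 2) = 0)
    (h5 : 2 * (E * v - u * F) * (F * w - u * v) = (F * v - u * G) * (E * w - u ^ 2)) :
    E * (G * w - v ^ 2) - F * (F * w - u * v) + u * (F * v - u * G) = 0 := by
  by_contra hD
  set D := E * (G * w - v ^ 2) - F * (F * w - u * v) + u * (F * v - u * G) with hDdef
  by_cases hA : G * w - v ^ 2 = 0
  · by_cases hS : E * G - F ^ 2 = 0
    · have e1 : D * (E * w - u ^ 2) * D = 0 := by
        have i1 : (E * G - F ^ 2) * (E * w - u ^ 2) - (E * v - u * F) ^ 2 = D * E := by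
          rw [hDdef]; ring
        have i2 : (G * w - v ^ 2) * (E * w - u ^ 2) - (F * w - u * v) ^ 2 = D * w := by
          rw [hDdef]; ring
        have i3 : (F * w - u * v) * (E * v - u * F) - (F * v - u * G) * (E * w - u ^ 2) = D * u := by
          rw [hDdef]; ring
        rw [hS, zero_mul, zero_sub] at i1
        rw [hA, zero_mul, zero_sub] at i2
        have i4 : -((F * w - u * v) * (E * v - u * F)) = D * u := by rw [← i3]; linarith
        have i5 : D * (E * w - u ^ 2) * D = (D * E) * (D * w) - (D * u) ^ 2 := by ring
        rw [i5, ← i1, ← i2, ← i4]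
        ring
      have e2 : E * w - u ^ 2 = 0 := by
        rcases mul_eq_zero.1 e1 with h | h
        · exact (mul_eq_zero.1 h).resolve_left hD
        · exact absurd h hD
      have e3 : (E * v - u * F) * (F * w - u * v) = 0 := by
        rw [e2] at h5; linarith
      have e4 : u = 0 := by
        have i3 : (F * w - u * v) * (E * v - u * F) - (F * v - u * G) * (E * w - u ^ 2) = D * u := by
          rw [hDdef]; ring
        rw [e2, mul_zero, sub_zero, mul_comm, e3] at i3
        exact (mul_eq_zero.1 i3.symm).resolve_left hD
      have e5 : F * w - u * v ≠ 0 := by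
        intro h0
        apply hD
        rw [hDdef, hA, h0, e4]; ring
      have e6 : E * v - u * F = 0 := (mul_eq_zero.1 e3).resolve_right e5
      have e7 : E = 0 := by
        have i1 : (E * G - F ^ 2) * (E * w - u ^ 2) - (E * v - u * F) ^ 2 = D * E := by
          rw [hDdef]; ring
        rw [hS, e6] at i1
        exact (mul_eq_zero.1 (by linarith : D * E = 0)).resolve_left hD
      have e8 : F = 0 := by
        rw [e7] at hS
        exact (pow_eq_zero_iff two_ne_zero).1 (by linarith)
      apply hD
      rw [hDdef, e4, e7, e8]; ring
    · have e1 : F * w - u * v = 0 := (mul_eq_zero.1 h1).resolve_left hS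
      have e2 : D = u * (F * v - u * G) := by rw [hDdef, hA, e1]; ring
      have e3 : E * w - u ^ 2 = 0 := by
        rw [e1, mul_zero] at h5
        refine (mul_eq_zero.1 h5.symm).resolve_left fun h0 => hD ?_
        rw [e2, h0, mul_zero]
      have i2 : (G * w - v ^ 2) * (E * w - u ^ 2) - (F * w - u * v) ^ 2 = D * w := by
        rw [hDdef]; ring
      rw [hA, e1] at i2
      have e4 : w = 0 := (mul_eq_zero.1 (by linarith : D * w = 0)).resolve_left hD
      have e5 : u = 0 := by
        rw [e4] at e3
        exact (pow_eq_zero_iff two_ne_zero).1 (by linarith)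
      exact hD (by rw [e2, e5, zero_mul])
  · have e1 := (mul_eq_zero.1 h2).resolve_right hA
    have e2 := (mul_eq_zero.1 h3).resolve_right hA
    have e3 := (mul_eq_zero.1 h4).resolve_right hA
    apply hD
    have : D = w * (E * G - F ^ 2) + u * (F * v - u * G) - v * (E * v - u * F) := by
      rw [hDdef]; ring
    rw [this, e1, e2, e3]; ring

/-- The polar form of the Gram determinant `x ↦ ⟨x, x⟩⟨b, b⟩ - ⟨x, b⟩²`. -/
def gramForm (b x y : L3) : ℝ := lprod x y * lprod b b - lprod x b * lprod y b

/-- A vector coplanar with `b` and `p` which lies, like `p`, in a plane not containing `b` is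
collinear with `p`. -/
theorem lcross_eq_zero_of_coplanar {ν b p y : L3} (hb : lprod ν b = 1) (hp : lprod ν p = 0)
    (hy : lprod ν y = 0) (h : lprod (lcross p y) b = 0) : lcross p y = 0 := by
  by_contra h0
  have h1 := eq_coordAlong_smul h0 (lcross_lcross_eq_zero hp hy)
  rw [h1, lprod_smul_left, h, mul_zero] at hb
  exact zero_ne_one hb

/-- The Gauss equation of a translation surface over a curve with velocity `a` in the plane
`⟨ν, ·⟩ = 0`, normalized so that the other velocity `B` satisfies `⟨ν, B⟩ = 1`, has no solution
with non-zero curvature. In an affine parameter of the directions of the plane, its two sides are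
polynomials, and comparing them for two values of `t` shows that `B` moves on a line
with direction `p` and that the Gram forms of all the `B(t)` are proportional. -/
theorem false_of_normalized_gauss {I J : Set ℝ} (hI : IsOpen I) (hIc : I.OrdConnected)
    (hIn : I.Nonempty) (hJ : IsOpen J) (hJc : J.OrdConnected) (hJn : J.Nonempty) {a B : ℝ → L3}
    (ha : ContDiffOn ℝ ∞ a I) (hB : ContDiffOn ℝ ∞ B J) {ν : L3} {ρ κ : ℝ → ℝ}
    (hνa : ∀ s ∈ I, lprod ν (a s) = 0) (hνB : ∀ t ∈ J, lprod ν (B t) = 1)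
    (hne : ∀ s ∈ I, lcross (a s) (deriv a s) ≠ 0) (hρ : ∀ t ∈ J, ρ t ≠ 0)
    (hκ : ∀ s ∈ I, κ s ≠ 0)
    (hL : ∀ s ∈ I, ∀ t ∈ J, lprod (lcross (a s) (B t)) (deriv B t) ≠ 0)
    (h : ∀ s ∈ I, ∀ t ∈ J, ρ t * gramForm (B t) (a s) (a s) ^ 2 =
      κ s * lprod (lcross (a s) (B t)) (deriv B t)) : False := by
  obtain ⟨s₀, hs₀⟩ := hIn
  obtain ⟨t₀, ht₀⟩ := hJn
  obtain ⟨hB1, hB0⟩ := smooth_deriv_and_differentiableAt hJ hB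
  obtain ⟨ha1, ha0⟩ := smooth_deriv_and_differentiableAt hI ha
  have hνB' : ∀ t ∈ J, lprod ν (deriv B t) = 0 := by
    intro t ht
    refine (hasDerivAt_lprod ν (hB0 t ht)).unique
      ((hasDerivAt_const t (1 : ℝ)).congr_of_eventuallyEq ?_)
    filter_upwards [hJ.mem_nhds ht] with t ht using hνB t ht
  set e := a s₀
  set b := B t₀ with hb
  set p := deriv B t₀ with hp
  have hLe : lprod (lcross e b) p ≠ 0 := hL s₀ hs₀ t₀ ht₀
  have hp0 : p ≠ 0 := by
    intro h0
    rw [h0] at hLe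
    simp [lprod] at hLe
  -- `a` in the basis `e, p` of the plane: `a = η (e + τ p)`
  set η : ℝ → ℝ := fun s => lprod (lcross (a s) b) p / lprod (lcross e b) p with hη
  have hη0 : ∀ s ∈ I, η s ≠ 0 := fun s hs => div_ne_zero (hL s hs t₀ ht₀) hLe
  set τ : ℝ → ℝ := fun s => coordAlong p ((η s)⁻¹ • a s - e) with hτ
  have haeq : ∀ s ∈ I, a s = η s • (e + τ s • p) := by
    intro s hs
    have h1 : lcross p ((η s)⁻¹ • a s - e) = 0 := by
      refine lcross_eq_zero_of_coplanar (ν := ν) (b := b) (hνB t₀ ht₀) (hνB' t₀ ht₀) ?_ ?_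
      · have : lprod ν ((η s)⁻¹ • a s - e) = (η s)⁻¹ * lprod ν (a s) - lprod ν e := by
          simp only [lprod, Pi.sub_apply, Pi.smul_apply, smul_eq_mul]; ring
        rw [this, hνa s hs, hνa s₀ hs₀]; ring
      · have h2 : lprod (lcross p ((η s)⁻¹ • a s - e)) b =
            (η s)⁻¹ * lprod (lcross (a s) b) p - lprod (lcross e b) p := by
          simp [lprod, lcross]; ring
        rw [h2]
        have h3 : lprod (lcross (a s) b) p ≠ 0 := hL s hs t₀ ht₀
        simp only [hη, inv_div]
        rw [div_mul_cancel₀ _ h3, sub_self]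
    have h2 := eq_coordAlong_smul hp0 h1
    rw [hτ]
    simp only
    rw [← h2, add_sub_cancel, smul_smul, mul_inv_cancel₀ (hη0 s hs), one_smul]
  have hηd : ∀ s ∈ I, DifferentiableAt ℝ η s := by
    intro s hs
    have h1 : ∀ x, lprod (lcross x b) p = lprod (lcross b p) x := by
      intro x; simp [lprod, lcross]; ring
    simp only [hη, h1]
    exact (hasDerivAt_lprod (lcross b p) (ha0 s hs)).differentiableAt.div_const _
  have hτc : ContinuousOn τ I := by
    have h1 : ContinuousOn (fun s => (η s)⁻¹ • a s - e) I := by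
      intro s hs
      exact ((((hηd s hs).continuousAt.inv₀ (hη0 s hs)).smul
        (ha0 s hs).continuousAt).sub continuousAt_const).continuousWithinAt
    have h2 := continuousOn_pi.1 h1
    simp only [hτ, coordAlong]
    exact (((continuousOn_const.mul (h2 0)).add (continuousOn_const.mul (h2 1))).add
      (continuousOn_const.mul (h2 2))).div_const _
  have hτinf : (τ '' I).Infinite := by
    by_cases hcst : ∀ s ∈ I, τ s = τ s₀
    · exfalso
      have h1 : a =ᶠ[nhds s₀] fun s => η s • (e + τ s₀ • p) := by
        filter_upwards [hI.mem_nhds hs₀] with s hs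
        rw [haeq s hs, hcst s hs]
      have h2 : deriv a s₀ = deriv η s₀ • (e + τ s₀ • p) :=
        (((hηd s₀ hs₀).hasDerivAt.smul_const _).congr_of_eventuallyEq h1).deriv
      apply hne s₀ hs₀
      rw [h2, haeq s₀ hs₀]
      funext i
      fin_cases i <;> simp [lcross] <;> ring
    · push Not at hcst
      obtain ⟨s, hs, h1⟩ := hcst
      exact infinite_image_of_not_const hIc hτc hs hs₀ h1
  -- comparison of the Gauss equations at `t` and at `t₀`
  have hprop : ∀ t ∈ J, lprod (lcross p (B t)) (deriv B t) = 0 ∧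
      ∃ k : ℝ, gramForm (B t) e e = k * gramForm b e e ∧
        2 * gramForm (B t) e p = k * (2 * gramForm b e p) ∧
        gramForm (B t) p p = k * gramForm b p p := by
    intro t ht
    have hQ : ∀ (c : L3) (r x : ℝ), gramForm c (r • (e + x • p)) (r • (e + x • p)) =
        r ^ 2 * (gramForm c e e + 2 * gramForm c e p * x + gramForm c p p * x ^ 2) := by
      intro c r x
      simp only [gramForm, lprod, Pi.add_apply, Pi.smul_apply, smul_eq_mul]; ring
    have hLl : ∀ (c d : L3) (r x : ℝ), lprod (lcross (r • (e + x • p)) c) d =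
        r * (lprod (lcross e c) d + lprod (lcross p c) d * x) := by
      intro c d r x
      simp [lprod, lcross]; ring
    have hpp : lprod (lcross p b) p = 0 := by simp [lprod, lcross]; ring
    have h0 : ∀ s ∈ I, ρ t * lprod (lcross e b) p *
        (gramForm (B t) e e + 2 * gramForm (B t) e p * τ s + gramForm (B t) p p * τ s ^ 2) ^ 2 =
        (gramForm b e e + 2 * gramForm b e p * τ s + gramForm b p p * τ s ^ 2) ^ 2 *
        (ρ t₀ * lprod (lcross e (B t)) (deriv B t) +
          ρ t₀ * lprod (lcross p (B t)) (deriv B t) * τ s) := by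
      intro s hs
      have h1 := h s hs t ht
      have h2 := h s hs t₀ ht₀
      rw [haeq s hs, hQ, hLl] at h1 h2
      rw [← hb, ← hp, hpp] at h2
      have hk : κ s * η s ^ 5 ≠ 0 := mul_ne_zero (hκ s hs) (pow_ne_zero _ (hη0 s hs))
      refine mul_left_cancel₀ hk ?_
      set l := lprod (lcross e (B t)) (deriv B t) + lprod (lcross p (B t)) (deriv B t) * τ s
        with hl
      linear_combination κ s * η s * lprod (lcross e b) p * h1 - κ s * η s * l * h2
    have h1 := proportional_of_sq_mul_eq (mul_ne_zero (hρ t ht) hLe) hτinf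
      (by rintro _ ⟨s, hs, rfl⟩; exact h0 s hs) (mem_image_of_mem τ hs₀) (by
        have h2 := h s₀ hs₀ t₀ ht₀
        rw [haeq s₀ hs₀, hQ] at h2
        intro h3
        rw [← hb, h3, ← haeq s₀ hs₀, mul_zero, zero_pow two_ne_zero, mul_zero] at h2
        exact mul_ne_zero (hκ s₀ hs₀) (hL s₀ hs₀ t₀ ht₀) h2.symm)
    exact ⟨(mul_eq_zero.1 h1.1).resolve_left (hρ t₀ ht₀), h1.2⟩
  -- `B` moves on a line
  set μ : ℝ → ℝ := fun t => coordAlong p (B t - b) with hμ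
  have hBeq : ∀ t ∈ J, B t = b + μ t • p := by
    intro t ht
    have h1 : ∀ t ∈ J, lcross p (deriv B t) = 0 := by
      intro t ht
      refine lcross_eq_zero_of_coplanar (hνB t ht) (hνB' t₀ ht₀) (hνB' t ht) ?_
      rw [← neg_eq_zero, ← (hprop t ht).1]
      simp [lprod, lcross]; ring
    have h2 : lcross p (B t - b) = 0 := by
      apply eq_zero_of_forall_lprod
      intro x
      have hsw : ∀ y, lprod (lcross p x) y = -lprod (lcross p y) x := by
        intro y; simp [lprod, lcross]; ring
      have h3 := lprod_eq_const hJ hJc hB0 (ν := lcross p x)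
        (fun t ht => by rw [hsw, h1 t ht]; simp [lprod]) ht ht₀
      rw [← neg_eq_zero, ← hsw]
      have : lprod (lcross p x) (B t - b) = lprod (lcross p x) (B t) - lprod (lcross p x) b := by
        simp only [lprod, Pi.sub_apply]; ring
      rw [this, h3, sub_self]
    rw [hμ]
    simp only
    rw [← eq_coordAlong_smul hp0 h2, add_sub_cancel]
  have hμinf : (μ '' J).Infinite := by
    by_cases hcst : ∀ t ∈ J, μ t = μ t₀
    · exfalso
      apply hp0
      have h1 : B =ᶠ[nhds t₀] fun _ => b + μ t₀ • p := by
        filter_upwards [hJ.mem_nhds ht₀] with t ht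
        rw [hBeq t ht, hcst t ht]
      exact ((hasDerivAt_const t₀ _).congr_of_eventuallyEq h1).deriv
    · push Not at hcst
      obtain ⟨t, ht, h1⟩ := hcst
      exact infinite_image_of_not_const hJc
        (contDiffOn_coordAlong (hB.sub contDiffOn_const) p).continuousOn ht ht₀ h1
  obtain ⟨m₁, hm₁, hm₁0⟩ := (hμinf.sdiff (finite_singleton 0)).nonempty
  obtain ⟨m₂, hm₂, hm₂0⟩ := (hμinf.sdiff ((finite_singleton m₁).insert 0)).nonempty
  simp only [mem_singleton_iff, mem_insert_iff, not_or] at hm₁0 hm₂0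
  have hQ : ∀ m : ℝ, ∀ x y, gramForm (b + m • p) x y = gramForm b x y +
      m * ((2 * lprod x y * lprod p b - lprod x b * lprod y p - lprod x p * lprod y b) +
        m * gramForm p x y) := by
    intro m x y
    simp only [gramForm, lprod, Pi.add_apply, Pi.smul_apply, smul_eq_mul]; ring
  have hminor : ∀ m ∈ μ '' J,
      gramForm (b + m • p) e e * gramForm b e p = gramForm (b + m • p) e p * gramForm b e e ∧
      gramForm (b + m • p) e e * gramForm b p p = gramForm (b + m • p) p p * gramForm b e e ∧
      gramForm (b + m • p) e p * gramForm b p p = gramForm (b + m • p) p p * gramForm b e p := by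
    rintro _ ⟨t, ht, rfl⟩
    obtain ⟨-, k, h1, h2, h3⟩ := hprop t ht
    have h2' : gramForm (B t) e p = k * gramForm b e p := by linarith
    rw [← hBeq t ht, h1, h2', h3]
    refine ⟨?_, ?_, ?_⟩ <;> ring
  -- an affine function of `m` vanishing at `m₁ ≠ m₂` has zero coefficients
  have haff : ∀ x y : ℝ, m₁ * (x + m₁ * y) = 0 → m₂ * (x + m₂ * y) = 0 → x = 0 ∧ y = 0 := by
    intro x y h1 h2
    have h1' := (mul_eq_zero.1 h1).resolve_left hm₁0
    have h2' := (mul_eq_zero.1 h2).resolve_left hm₂0.1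
    have h3 : (m₂ - m₁) * y = 0 := by linarith
    have hy := (mul_eq_zero.1 h3).resolve_left (sub_ne_zero.2 hm₂0.2)
    exact ⟨by rw [hy] at h1'; linarith, hy⟩
  have hm1 := hminor m₁ hm₁
  have hm2 := hminor m₂ hm₂
  simp only [hQ] at hm1 hm2
  simp only [gramForm] at hm1 hm2
  set E := lprod e e
  set F := lprod e p
  set G := lprod p p
  set u := lprod e b
  set v := lprod p b
  set w := lprod b b
  obtain ⟨x1, y1⟩ := haff (2 * ((E * v - u * F) * (F * w - u * v)) -
      (F * v - u * G) * (E * w - u ^ 2)) ((E * G - F ^ 2) * (F * w - u * v))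
    (by linear_combination hm1.1) (by linear_combination hm2.1)
  obtain ⟨x2, y2⟩ := haff (2 * ((E * v - u * F) * (G * w - v ^ 2)))
    ((E * G - F ^ 2) * (G * w - v ^ 2))
    (by linear_combination hm1.2.1) (by linear_combination hm2.2.1)
  obtain ⟨x3, -⟩ := haff ((F * v - u * G) * (G * w - v ^ 2)) 0
    (by linear_combination hm1.2.2) (by linear_combination hm2.2.2)
  have hfin := gram_eq_zero_of_minors y1 y2 x3 (by linarith) (by linarith)
  have hgram : E * (G * w - v ^ 2) - F * (F * w - u * v) + u * (F * v - u * G) =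
      -lprod (lcross e b) p ^ 2 := by
    simp only [E, F, G, u, v, w]
    simp [lprod, lcross]; ring
  rw [hgram] at hfin
  exact hLe ((pow_eq_zero_iff two_ne_zero).1 (neg_eq_zero.1 hfin))

/-- The velocities of a translation surface of constant Gauss curvature `K ≠ 0` satisfy the Gauss
equation, which is impossible if one of them stays in a plane. -/
theorem false_of_gauss_of_planar {I J : Set ℝ} (hI : IsOpen I) (hIc : I.OrdConnected)
    (hIn : I.Nonempty) (hJ : IsOpen J) (hJc : J.OrdConnected) (hJn : J.Nonempty) {a b : ℝ → L3}
    (ha : ContDiffOn ℝ ∞ a I) (hb : ContDiffOn ℝ ∞ b J) {ν : L3} {K : ℝ} (hK : K ≠ 0)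
    (hνa : ∀ s ∈ I, lprod ν (a s) = 0)
    (hW : ∀ s ∈ I, ∀ t ∈ J, lprod (a s) (a s) * lprod (b t) (b t) - lprod (a s) (b t) ^ 2 ≠ 0)
    (h : ∀ s ∈ I, ∀ t ∈ J,
      K * (lprod (a s) (a s) * lprod (b t) (b t) - lprod (a s) (b t) ^ 2) ^ 2 =
      -(lprod (lcross (a s) (b t)) (deriv a s) * lprod (lcross (a s) (b t)) (deriv b t)))
    (hν : ν ≠ 0) : False := by
  obtain ⟨hb1, hb0⟩ := smooth_deriv_and_differentiableAt hJ hb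
  obtain ⟨ha1, ha0⟩ := smooth_deriv_and_differentiableAt hI ha
  obtain ⟨i₀, hi₀⟩ := id hIn
  obtain ⟨j₀, hj₀⟩ := id hJn
  have hνa' : ∀ s ∈ I, lprod ν (deriv a s) = 0 := by
    intro s hs
    refine (hasDerivAt_lprod ν (ha0 s hs)).unique
      ((hasDerivAt_const s (0 : ℝ)).congr_of_eventuallyEq ?_)
    filter_upwards [hI.mem_nhds hs] with s hs using hνa s hs
  have hD : ∀ s ∈ I, ∀ t ∈ J, lprod (lcross (a s) (b t)) (deriv a s) ≠ 0 ∧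
      lprod (lcross (a s) (b t)) (deriv b t) ≠ 0 := by
    intro s hs t ht
    have h1 : K * (lprod (a s) (a s) * lprod (b t) (b t) - lprod (a s) (b t) ^ 2) ^ 2 ≠ 0 :=
      mul_ne_zero hK (pow_ne_zero _ (hW s hs t ht))
    rw [h s hs t ht, neg_ne_zero] at h1
    exact mul_ne_zero_iff.1 h1
  have hsw : ∀ x y z, lprod (lcross x y) z = -lprod (lcross x z) y := by
    intro x y z; simp [lprod, lcross]; ring
  have hne : ∀ s ∈ I, lcross (a s) (deriv a s) ≠ 0 := by
    intro s hs h0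
    apply (hD s hs j₀ hj₀).1
    rw [hsw, h0]; simp [lprod]
  set c : ℝ → ℝ := fun s => coordAlong (lcross (a s) (deriv a s)) ν with hc
  have hνc : ∀ s ∈ I, ν = c s • lcross (a s) (deriv a s) := fun s hs =>
    eq_coordAlong_smul (hne s hs) (lcross_lcross_eq_zero (hνa s hs) (hνa' s hs))
  have hc0 : ∀ s ∈ I, c s ≠ 0 := by
    intro s hs h0
    apply hν
    rw [hνc s hs, h0, zero_smul]
  set m : ℝ → ℝ := fun t => lprod ν (b t) with hm
  have hm0 : ∀ t ∈ J, m t ≠ 0 := by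
    intro t ht
    simp only [hm]
    rw [hνc i₀ hi₀, lprod_smul_left]
    refine mul_ne_zero (hc0 i₀ hi₀) fun h0 => (hD i₀ hi₀ t ht).1 ?_
    rw [hsw, h0, neg_zero]
  have hms : ContDiffOn ℝ ∞ m J := by
    have h1 := contDiffOn_pi.1 hb
    exact ((contDiffOn_const.mul (h1 0)).add (contDiffOn_const.mul (h1 1))).sub
      (contDiffOn_const.mul (h1 2))
  have hmd := (smooth_deriv_and_differentiableAt hJ hms).2
  set B : ℝ → L3 := fun t => (m t)⁻¹ • b t with hBdef
  have hB : ContDiffOn ℝ ∞ B J := (hms.inv hm0).smul hb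
  have hBd := (smooth_deriv_and_differentiableAt hJ hB).2
  have hbB : ∀ t ∈ J, b t = m t • B t := by
    intro t ht
    simp only [hBdef]
    rw [smul_smul, mul_inv_cancel₀ (hm0 t ht), one_smul]
  have hbB' : ∀ t ∈ J, deriv b t = m t • deriv B t + deriv m t • B t := by
    intro t ht
    have h1 : b =ᶠ[nhds t] fun t => m t • B t := by
      filter_upwards [hJ.mem_nhds ht] with t ht using hbB t ht
    exact (((hmd t ht).hasDerivAt.smul (hBd t ht).hasDerivAt).congr_of_eventuallyEq h1).deriv
  have hνB : ∀ t ∈ J, lprod ν (B t) = 1 := by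
    intro t ht
    have h1 : m t = m t * lprod ν (B t) := by
      conv_lhs => rw [hm]
      simp only
      conv_lhs => rw [hbB t ht]
      simp only [lprod, Pi.smul_apply, smul_eq_mul]; ring
    exact mul_left_cancel₀ (hm0 t ht) (by linarith)
  have hLB : ∀ s ∈ I, ∀ t ∈ J, lprod (lcross (a s) (b t)) (deriv b t) =
      m t ^ 2 * lprod (lcross (a s) (B t)) (deriv B t) := by
    intro s hs t ht
    rw [hbB' t ht, hbB t ht]
    simp [lprod, lcross]; ring
  have hDB : ∀ s ∈ I, ∀ t ∈ J, c s * lprod (lcross (a s) (b t)) (deriv a s) = -m t := by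
    intro s hs t ht
    rw [hsw, mul_neg, ← lprod_smul_left, ← hνc s hs]
  refine false_of_normalized_gauss hI hIc hIn hJ hJc hJn ha hB (ρ := fun t => K * m t)
    (κ := fun s => (c s)⁻¹) hνa hνB hne (fun t ht => mul_ne_zero hK (hm0 t ht))
    (fun s hs => inv_ne_zero (hc0 s hs)) ?_ ?_
  · intro s hs t ht h0
    apply (hD s hs t ht).2
    rw [hLB s hs t ht, h0, mul_zero]
  · intro s hs t ht
    have h1 := h s hs t ht
    rw [hLB s hs t ht] at h1
    have h2 : lprod (a s) (a s) * lprod (b t) (b t) - lprod (a s) (b t) ^ 2 =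
        m t ^ 2 * gramForm (B t) (a s) (a s) := by
      rw [hbB t ht]
      simp only [gramForm, lprod, Pi.smul_apply, smul_eq_mul]; ring
    rw [h2] at h1
    have h3 := hDB s hs t ht
    have hcs := hc0 s hs
    have hmt := hm0 t ht
    rw [← mul_right_inj' (mul_ne_zero hcs (pow_ne_zero 3 hmt))]
    have h4 : c s * m t ^ 3 * ((c s)⁻¹ * lprod (lcross (a s) (B t)) (deriv B t)) =
        m t ^ 3 * lprod (lcross (a s) (B t)) (deriv B t) := by
      field_simp
    rw [h4]
    linear_combination c s * h1 - m t ^ 2 * lprod (lcross (a s) (B t)) (deriv B t) * h3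

/-- A non-degenerate translation surface with a planar curve does not have constant non-zero
Gauss curvature. -/
theorem IsTranslationSurface.not_const_gaussK {I J : Set ℝ} {α β : ℝ → L3} {X : ℝ × ℝ → L3}
    {K : ℝ} (h : IsTranslationSurface I J α β X) (hX : IsNondegenerateOn (I ×ˢ J) X)
    (hP : IsPlanarOn I α ∨ IsPlanarOn J β) (hK0 : K ≠ 0) :
    ¬ ∀ p ∈ I ×ˢ J, gaussK X p = K := by
  intro hK
  obtain ⟨hI, hIc, hIn⟩ := h.interval_left
  obtain ⟨hJ, hJc, hJn⟩ := h.interval_right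
  obtain ⟨hα1, hα0⟩ := smooth_deriv_and_differentiableAt hI h.smooth_left
  obtain ⟨hβ1, hβ0⟩ := smooth_deriv_and_differentiableAt hJ h.smooth_right
  have hplane : ∀ {I : Set ℝ} {α : ℝ → L3}, IsOpen I → (∀ s ∈ I, DifferentiableAt ℝ α s) →
      IsPlanarOn I α → ∃ ν : L3, ν ≠ 0 ∧ ∀ s ∈ I, lprod ν (deriv α s) = 0 := by
    rintro I α hI hα ⟨ν, c, hν, h1⟩
    refine ⟨![ν 0, ν 1, -ν 2], fun h0 => hν ?_, fun s hs => ?_⟩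
    · funext i
      have := congrFun h0 i
      fin_cases i <;> simpa using this
    · refine (hasDerivAt_lprod _ (hα s hs)).unique
        ((hasDerivAt_const s c).congr_of_eventuallyEq ?_)
      filter_upwards [hI.mem_nhds hs] with s hs
      rw [← h1 s hs]
      simp [lprod]
  rcases hP with hP | hP
  · obtain ⟨ν, hν, hνa⟩ := hplane hI hα0 hP
    refine false_of_gauss_of_planar hI hIc hIn hJ hJc hJn hα1 hβ1 hK0 hνa
      (fun s hs t ht => (h.gauss hX hs ht).1) (fun s hs t ht => ?_) hν
    rw [← (h.gauss hX hs ht).2, hK _ ⟨hs, ht⟩]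
  · obtain ⟨ν, hν, hνb⟩ := hplane hJ hβ0 hP
    refine false_of_gauss_of_planar hJ hJc hJn hI hIc hIn hβ1 hα1 hK0 hνb
      (fun t ht s hs h0 => (h.gauss hX hs ht).1 ?_) (fun t ht s hs => ?_) hν
    · rw [← h0]; simp only [lprod]; ring
    · have h1 := (h.gauss hX hs ht).2
      rw [hK _ ⟨hs, ht⟩] at h1
      rw [lprod_lcross_swap (deriv α s), lprod_lcross_swap (deriv α s)]
      have h2 : ∀ x y : L3, lprod x y = lprod y x := by
        intro x y; simp only [lprod]; ring
      rw [h2 (deriv β t) (deriv α s)]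
      linear_combination h1

/-! ### Graphs of products with constant non-zero curvature -/

theorem coeff_eq_zero_of_infinite {T : Set ℝ} (hT : T.Infinite) {c0 c1 c2 c3 : ℝ}
    (h : ∀ x ∈ T, c0 + c1 * x + c2 * x ^ 2 + c3 * x ^ 3 = 0) :
    c0 = 0 ∧ c1 = 0 ∧ c2 = 0 ∧ c3 = 0 := by
  set q : Polynomial ℝ := .C c0 + .C c1 * .X + .C c2 * .X ^ 2 + .C c3 * .X ^ 3 with hq
  have h0 : q = 0 := by
    refine Polynomial.eq_of_infinite_eval_eq _ _ (hT.mono fun x hx => ?_)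
    simpa [hq] using h x hx
  refine ⟨?_, ?_, ?_, ?_⟩
  · simpa [hq] using congrArg (fun p => Polynomial.coeff p 0) h0
  · simpa [hq, Polynomial.coeff_X, Polynomial.coeff_C, Polynomial.coeff_X_pow] using
      congrArg (fun p => Polynomial.coeff p 1) h0
  · simpa [hq, Polynomial.coeff_X, Polynomial.coeff_C, Polynomial.coeff_X_pow] using
      congrArg (fun p => Polynomial.coeff p 2) h0
  · simpa [hq, Polynomial.coeff_X, Polynomial.coeff_C, Polynomial.coeff_X_pow] using
      congrArg (fun p => Polynomial.coeff p 3) h0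

theorem infinite_image_sq {I : Set ℝ} (hI : IsOpen I) (hIc : I.OrdConnected) {f : ℝ → ℝ}
    (hf : ContDiffOn ℝ ∞ f I) {x₀ : ℝ} (hx₀ : x₀ ∈ I) (h0 : deriv f x₀ ≠ 0) :
    ((fun x => f x ^ 2) '' I).Infinite := by
  have hfd := (smooth_deriv_and_differentiableAt hI hf).2
  by_cases hc : ∀ x ∈ I, f x ^ 2 = f x₀ ^ 2
  · exfalso
    have h1 : (fun x => f x ^ 2) =ᶠ[nhds x₀] fun _ => f x₀ ^ 2 := by
      filter_upwards [hI.mem_nhds hx₀] with x hx using hc x hx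
    have h2 := ((hfd x₀ hx₀).hasDerivAt.pow 2).unique
      ((hasDerivAt_const x₀ (f x₀ ^ 2)).congr_of_eventuallyEq h1)
    have h3 : f x₀ = 0 := by simpa [h0] using h2
    have h4 : f =ᶠ[nhds x₀] fun _ => 0 := by
      filter_upwards [hI.mem_nhds hx₀] with x hx
      have := hc x hx
      rw [h3] at this
      simpa using this
    exact h0 (((hasDerivAt_const x₀ (0 : ℝ)).congr_of_eventuallyEq h4).deriv)
  · push Not at hc
    obtain ⟨x, hx, h1⟩ := hc
    exact infinite_image_of_not_const hIc (hf.continuousOn.pow 2) hx hx₀ h1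

/-- The functions of one variable which occur in the Gauss equation of the graph of a product. -/
noncomputable def gaussVec (f : ℝ → ℝ) (x : ℝ) : Fin 7 → ℝ :=
  ![deriv f x ^ 2, f x * deriv (deriv f) x, 1, f x ^ 2, deriv f x ^ 4, f x ^ 2 * deriv f x ^ 2,
    f x ^ 4]

theorem exists_relation_of_finrank_le {V : Submodule ℝ (Fin 7 → ℝ)}
    (hV : Module.finrank ℝ V ≤ 3) (i : Fin 4 → Fin 7) :
    ∃ c : Fin 4 → ℝ, c ≠ 0 ∧ ∀ v ∈ V, ∑ k, c k * v (i k) = 0 := by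
  let F : Fin 4 → Module.Dual ℝ V := fun k => (LinearMap.proj (i k)).comp V.subtype
  have hF : ¬ LinearIndependent ℝ F := by
    intro h
    have h1 := h.fintype_card_le_finrank
    rw [Subspace.dual_finrank_eq, Fintype.card_fin] at h1
    omega
  obtain ⟨c, hc, k, hk⟩ := Fintype.not_linearIndependent_iff.1 hF
  refine ⟨c, fun h => hk (congrFun h k), fun v hv => ?_⟩
  have h1 := congrArg (fun φ : Module.Dual ℝ V => φ ⟨v, hv⟩) hc
  simpa [F] using h1

/-- If the functions in the Gauss equation span a space of dimension at most `3`, which then is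
the span of `1, f², f⁴`, then `f'²` is an affine function of `f²`: both `f'²` and `f² f'²` are
quadratic polynomials in `f²`. -/
theorem deriv_sq_eq_affine {I : Set ℝ} {f : ℝ → ℝ} (hT : ((fun x => f x ^ 2) '' I).Infinite)
    (hV : Module.finrank ℝ (Submodule.span ℝ (gaussVec f '' I)) ≤ 3) :
    ∃ α β : ℝ, ∀ x ∈ I, deriv f x ^ 2 = α + β * f x ^ 2 := by
  have hmem : ∀ x ∈ I, gaussVec f x ∈ Submodule.span ℝ (gaussVec f '' I) :=
    fun x hx => Submodule.subset_span (mem_image_of_mem _ hx)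
  have hquad : ∀ (j : Fin 7), ∃ p0 p1 p2 : ℝ, ∀ x ∈ I,
      gaussVec f x j = p0 + p1 * f x ^ 2 + p2 * f x ^ 4 := by
    intro j
    obtain ⟨c, hc, h⟩ := exists_relation_of_finrank_le hV ![2, 3, 6, j]
    have h1 : ∀ x ∈ I, c 0 + c 1 * f x ^ 2 + c 2 * f x ^ 4 + c 3 * gaussVec f x j = 0 := by
      intro x hx
      have := h _ (hmem x hx)
      simpa [Fin.sum_univ_four, gaussVec] using this
    have h3 : c 3 ≠ 0 := by
      intro h3
      obtain ⟨e0, e1, e2, -⟩ := coeff_eq_zero_of_infinite hT (c0 := c 0) (c1 := c 1) (c2 := c 2)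
        (c3 := 0) (by
          rintro _ ⟨x, hx, rfl⟩
          have := h1 x hx
          rw [h3] at this
          linear_combination this)
      apply hc
      funext k
      fin_cases k <;> assumption
    refine ⟨-c 0 / c 3, -c 1 / c 3, -c 2 / c 3, fun x hx => ?_⟩
    have := h1 x hx
    field_simp
    linarith
  obtain ⟨p0, p1, p2, hp⟩ := hquad 0
  obtain ⟨r0, r1, r2, hr⟩ := hquad 5
  obtain ⟨-, -, -, e3⟩ := coeff_eq_zero_of_infinite hT (c0 := -r0) (c1 := p0 - r1)
    (c2 := p1 - r2) (c3 := p2) (by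
      rintro _ ⟨x, hx, rfl⟩
      have h1 := hp x hx
      have h2 := hr x hx
      simp [gaussVec] at h1 h2
      rw [h1] at h2
      linear_combination h2)
  refine ⟨p0, p1, fun x hx => ?_⟩
  have h1 := hp x hx
  simp [gaussVec, e3] at h1
  exact h1

/-- If `f'² = α + β f²`, the Gauss equation is polynomial in `f²`. Its quadratic coefficient
determines `g'²`, and its constant coefficient then shows that the curvature vanishes. -/
theorem curvature_eq_zero_of_affine {I J : Set ℝ} (hI : IsOpen I) {f g : ℝ → ℝ}
    (hf : ContDiffOn ℝ ∞ f I) (hTf : ((fun x => f x ^ 2) '' I).Infinite)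
    (hTg : ((fun y => g y ^ 2) '' J).Infinite) {x₀ : ℝ} (hx₀ : x₀ ∈ I) (hd : deriv f x₀ ≠ 0)
    {K ε₁ ε₂ : ℝ} (hε₂ : ε₂ ^ 2 = 1)
    (h : ∀ x ∈ I, ∀ y ∈ J,
      K * (1 + ε₁ * deriv f x ^ 2 * g y ^ 2 + ε₂ * f x ^ 2 * deriv g y ^ 2) ^ 2 =
        deriv f x ^ 2 * deriv g y ^ 2 - f x * deriv (deriv f) x * (g y * deriv (deriv g) y))
    {α β : ℝ} (haff : ∀ x ∈ I, deriv f x ^ 2 = α + β * f x ^ 2) : K = 0 := by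
  by_contra hK
  obtain ⟨hf1, hf0⟩ := smooth_deriv_and_differentiableAt hI hf
  have hf2 := (smooth_deriv_and_differentiableAt hI hf1).2
  have hff : ∀ x ∈ I, deriv f x ≠ 0 → deriv (deriv f) x = β * f x := by
    intro x hx hx0
    have h1 : (fun x => deriv f x ^ 2) =ᶠ[nhds x] fun x => α + β * f x ^ 2 := by
      filter_upwards [hI.mem_nhds hx] with x hx using haff x hx
    have h2 := ((hf2 x hx).hasDerivAt.pow 2).unique
      (((((hf0 x hx).hasDerivAt.pow 2).const_mul β).const_add α).congr_of_eventuallyEq h1)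
    simp only [Nat.add_one_sub_one, pow_one, Nat.cast_ofNat] at h2
    refine mul_left_cancel₀ hx0 ?_
    linarith
  have hfin : {U : ℝ | α + β * U = 0}.Finite := by
    by_contra hinf
    obtain ⟨e0, e1, -, -⟩ := coeff_eq_zero_of_infinite hinf (c0 := α) (c1 := β) (c2 := 0)
      (c3 := 0) (fun x hx => by
        have : α + β * x = 0 := hx
        linarith)
    have := haff x₀ hx₀
    rw [e0, e1] at this
    apply hd
    simpa using this
  have hT := hTf.sdiff hfin
  have hcoef : ∀ y ∈ J, α * deriv g y ^ 2 = K * (1 + ε₁ * α * g y ^ 2) ^ 2 ∧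
      ε₁ * β * g y ^ 2 + ε₂ * deriv g y ^ 2 = 0 := by
    intro y hy
    obtain ⟨e0, -, e2, -⟩ := coeff_eq_zero_of_infinite hT
      (c0 := α * deriv g y ^ 2 - K * (1 + ε₁ * α * g y ^ 2) ^ 2)
      (c1 := β * deriv g y ^ 2 - β * (g y * deriv (deriv g) y) -
        2 * K * (1 + ε₁ * α * g y ^ 2) * (ε₁ * β * g y ^ 2 + ε₂ * deriv g y ^ 2))
      (c2 := -K * (ε₁ * β * g y ^ 2 + ε₂ * deriv g y ^ 2) ^ 2) (c3 := 0) (by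
        rintro _ ⟨⟨x, hx, rfl⟩, hx0⟩
        have hx1 : deriv f x ≠ 0 := by
          intro h0
          apply hx0
          have := haff x hx
          rw [h0] at this
          simpa using this.symm
        have h1 := h x hx y hy
        rw [hff x hx hx1, haff x hx] at h1
        linear_combination -h1)
    refine ⟨by linarith, ?_⟩
    have := (mul_eq_zero.1 e2).resolve_left (neg_ne_zero.2 hK)
    exact (pow_eq_zero_iff two_ne_zero).1 this
  obtain ⟨e0, -, -, -⟩ := coeff_eq_zero_of_infinite hTg (c0 := K)
    (c1 := 2 * K * (ε₁ * α) + α * β * ε₁ * ε₂) (c2 := K * (ε₁ * α) ^ 2) (c3 := 0) (by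
      rintro _ ⟨y, hy, rfl⟩
      obtain ⟨h1, h2⟩ := hcoef y hy
      simp only
      linear_combination -h1 + α * ε₂ * h2 - α * deriv g y ^ 2 * hε₂)
  exact hK e0

/-- The bilinear form on `ℝ⁷` for which the Gauss equation of the graph of `f(x) g(y)` says that
the vectors `gaussVec f x` and `gaussVec g y` are orthogonal. -/
noncomputable def gaussBilin (K ε₁ ε₂ : ℝ) : (Fin 7 → ℝ) →ₗ[ℝ] (Fin 7 → ℝ) →ₗ[ℝ] ℝ :=
  LinearMap.mk₂ ℝ (fun u v => u 0 * v 0 - u 1 * v 1 - K * (u 2 * v 2) - 2 * K * ε₁ * (u 0 * v 3)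
      - 2 * K * ε₂ * (u 3 * v 0) - K * (u 4 * v 6) - 2 * K * ε₁ * ε₂ * (u 5 * v 5)
      - K * (u 6 * v 4))
    (fun u u' v => by simp only [Pi.add_apply]; ring)
    (fun c u v => by simp only [Pi.smul_apply, smul_eq_mul]; ring)
    (fun u v v' => by simp only [Pi.add_apply]; ring)
    (fun c u v => by simp only [Pi.smul_apply, smul_eq_mul]; ring)

theorem gaussBilin_apply (K ε₁ ε₂ : ℝ) (u v : Fin 7 → ℝ) : gaussBilin K ε₁ ε₂ u v =
    u 0 * v 0 - u 1 * v 1 - K * (u 2 * v 2) - 2 * K * ε₁ * (u 0 * v 3)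
      - 2 * K * ε₂ * (u 3 * v 0) - K * (u 4 * v 6) - 2 * K * ε₁ * ε₂ * (u 5 * v 5)
      - K * (u 6 * v 4) := rfl

theorem gaussBilin_injective {K ε₁ ε₂ : ℝ} (hK : K ≠ 0) (hε₁ : ε₁ ^ 2 = 1) (hε₂ : ε₂ ^ 2 = 1) :
    Function.Injective (gaussBilin K ε₁ ε₂) := by
  have h1 : ε₁ ≠ 0 := by rintro rfl; norm_num at hε₁
  have h2 : ε₂ ≠ 0 := by rintro rfl; norm_num at hε₂
  rw [← LinearMap.ker_eq_bot, LinearMap.ker_eq_bot']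
  intro u hu
  have h : ∀ k, gaussBilin K ε₁ ε₂ u (Pi.single k 1) = 0 := fun k => by rw [hu]; rfl
  have e0 : u 0 = 0 := by simpa [gaussBilin_apply, Pi.single_apply, hK, h1] using h 3
  have e1 : u 1 = 0 := by simpa [gaussBilin_apply, Pi.single_apply] using h 1
  have e2 : u 2 = 0 := by simpa [gaussBilin_apply, Pi.single_apply, hK] using h 2
  have e3 : u 3 = 0 := by simpa [gaussBilin_apply, Pi.single_apply, hK, h2, e0] using h 0
  have e4 : u 4 = 0 := by simpa [gaussBilin_apply, Pi.single_apply, hK] using h 6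
  have e5 : u 5 = 0 := by simpa [gaussBilin_apply, Pi.single_apply, hK, h1, h2] using h 5
  have e6 : u 6 = 0 := by simpa [gaussBilin_apply, Pi.single_apply, hK] using h 4
  funext k
  fin_cases k <;> assumption

/-- The graph of a product `f(x) g(y)` does not have constant non-zero Gauss curvature. The Gauss
equation makes the spans of the vectors `gaussVec f x` and `gaussVec g y` orthogonal
in dimension `7`, so that one of the two spans has dimension at most `3`. -/
theorem curvature_eq_zero_of_product {I J : Set ℝ} (hI : IsOpen I) (hIc : I.OrdConnected)
    (hIn : I.Nonempty) (hJ : IsOpen J) (hJc : J.OrdConnected) (hJn : J.Nonempty) {f g : ℝ → ℝ}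
    (hf : ContDiffOn ℝ ∞ f I) (hg : ContDiffOn ℝ ∞ g J)
    {K ε₁ ε₂ : ℝ} (hε₁ : ε₁ ^ 2 = 1) (hε₂ : ε₂ ^ 2 = 1)
    (hW : ∀ x ∈ I, ∀ y ∈ J,
      1 + ε₁ * deriv f x ^ 2 * g y ^ 2 + ε₂ * f x ^ 2 * deriv g y ^ 2 ≠ 0)
    (h : ∀ x ∈ I, ∀ y ∈ J,
      K * (1 + ε₁ * deriv f x ^ 2 * g y ^ 2 + ε₂ * f x ^ 2 * deriv g y ^ 2) ^ 2 =
        deriv f x ^ 2 * deriv g y ^ 2 - f x * deriv (deriv f) x * (g y * deriv (deriv g) y)) :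
    K = 0 := by
  by_contra hK
  obtain ⟨i₀, hi₀⟩ := hIn
  obtain ⟨j₀, hj₀⟩ := hJn
  have hconst : ∀ {I : Set ℝ} {f : ℝ → ℝ}, IsOpen I → (∀ x ∈ I, deriv f x = 0) →
      ∀ x ∈ I, deriv (deriv f) x = 0 := by
    intro I f hI h0 x hx
    have h1 : deriv f =ᶠ[nhds x] fun _ => 0 := by
      filter_upwards [hI.mem_nhds hx] with x hx using h0 x hx
    exact ((hasDerivAt_const x (0 : ℝ)).congr_of_eventuallyEq h1).deriv
  have hL := mul_ne_zero hK (pow_ne_zero 2 (hW i₀ hi₀ j₀ hj₀))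
  obtain ⟨x₀, hx₀, hfx⟩ : ∃ x ∈ I, deriv f x ≠ 0 := by
    by_contra h0
    push Not at h0
    rw [h i₀ hi₀ j₀ hj₀, h0 i₀ hi₀, hconst hI h0 i₀ hi₀] at hL
    simp at hL
  obtain ⟨y₀, hy₀, hgy⟩ : ∃ y ∈ J, deriv g y ≠ 0 := by
    by_contra h0
    push Not at h0
    rw [h i₀ hi₀ j₀ hj₀, h0 j₀ hj₀, hconst hJ h0 j₀ hj₀] at hL
    simp at hL
  have hTf := infinite_image_sq hI hIc hf hx₀ hfx
  have hTg := infinite_image_sq hJ hJc hg hy₀ hgy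
  set V := Submodule.span ℝ (gaussVec f '' I) with hV
  set W := Submodule.span ℝ (gaussVec g '' J) with hWdef
  have horth : V.map (gaussBilin K ε₁ ε₂) ≤ W.dualAnnihilator := by
    rw [hV, Submodule.map_span_le]
    rintro _ ⟨x, hx, rfl⟩
    rw [Submodule.mem_dualAnnihilator]
    intro w hw
    have h1 : W ≤ LinearMap.ker (gaussBilin K ε₁ ε₂ (gaussVec f x)) := by
      rw [hWdef, Submodule.span_le]
      rintro _ ⟨y, hy, rfl⟩
      have h2 := h x hx y hy
      simp only [SetLike.mem_coe, LinearMap.mem_ker, gaussBilin_apply]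
      simp [gaussVec]
      linear_combination -h2 + K * deriv f x ^ 4 * g y ^ 4 * hε₁ +
        K * f x ^ 4 * deriv g y ^ 4 * hε₂
    exact h1 hw
  have hdim : Module.finrank ℝ V + Module.finrank ℝ W ≤ 7 := by
    have h1 := Submodule.finrank_mono horth
    rw [← (Submodule.equivMapOfInjective _ (gaussBilin_injective hK hε₁ hε₂) V).finrank_eq] at h1
    have h2 := Subspace.finrank_add_finrank_dualAnnihilator_eq W
    rw [Module.finrank_fin_fun, add_comm] at h2
    exact (Nat.add_le_add_right h1 _).trans h2.le
  rcases (by omega : Module.finrank ℝ V ≤ 3 ∨ Module.finrank ℝ W ≤ 3) with h3 | h3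
  · obtain ⟨α, β, haff⟩ := deriv_sq_eq_affine hTf h3
    exact hK (curvature_eq_zero_of_affine hI hf hTf hTg hx₀ hfx hε₂ h haff)
  · obtain ⟨α, β, haff⟩ := deriv_sq_eq_affine hTg h3
    refine hK (curvature_eq_zero_of_affine (ε₁ := ε₂) hJ hg hTg hTf hy₀ hgy hε₁ ?_ haff)
    intro y hy x hx
    linear_combination h x hx y hy

/-! ### The differential equation `f f'' = μ f'²` -/

theorem sign_const_of_ne_zero {I : Set ℝ} (hIc : I.OrdConnected) {f : ℝ → ℝ}
    (hf : ContinuousOn f I) (h0 : ∀ x ∈ I, f x ≠ 0) :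
    ∃ σ : ℝ, (σ = 1 ∨ σ = -1) ∧ ∀ x ∈ I, 0 < σ * f x := by
  by_cases hp : ∀ x ∈ I, 0 < f x
  · exact ⟨1, Or.inl rfl, fun x hx => by rw [one_mul]; exact hp x hx⟩
  · push Not at hp
    obtain ⟨x, hx, hx0⟩ := hp
    refine ⟨-1, Or.inr rfl, fun y hy => ?_⟩
    by_contra hy0
    obtain ⟨z, hz, hz0⟩ := hIc.isPreconnected.intermediate_value hx hy hf
      ⟨hx0, (by linarith : (0 : ℝ) ≤ f y)⟩
    exact h0 z hz hz0

theorem smooth_iteratedDeriv {I : Set ℝ} (hI : IsOpen I) {f : ℝ → ℝ} (hf : ContDiffOn ℝ ∞ f I)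
    (k : ℕ) : ContDiffOn ℝ ∞ (iteratedDeriv k f) I := by
  induction k with
  | zero => simpa using hf
  | succ k ih =>
    rw [iteratedDeriv_succ]
    exact (smooth_deriv_and_differentiableAt hI ih).1

/-- A first integral of `F F'' = μ F'²`: the quantity `F^(-μ) F'` is constant. -/
theorem exists_deriv_eq_const_mul_rpow {I : Set ℝ} (hI : IsOpen I) (hIc : I.OrdConnected)
    {F : ℝ → ℝ} (hF : ContDiffOn ℝ ∞ F I) {μ : ℝ} (hpos : ∀ x ∈ I, 0 < F x)
    (h : ∀ x ∈ I, F x * deriv (deriv F) x = μ * deriv F x ^ 2) :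
    ∃ c : ℝ, ∀ x ∈ I, deriv F x = c * F x ^ μ := by
  obtain ⟨hF1, hF0⟩ := smooth_deriv_and_differentiableAt hI hF
  have hF2 := (smooth_deriv_and_differentiableAt hI hF1).2
  have hd : ∀ x ∈ I, HasDerivAt (fun x => F x ^ (-μ) * deriv F x) 0 x := by
    intro x hx
    have h1 := ((hF0 x hx).hasDerivAt.rpow_const (p := -μ) (Or.inl (hpos x hx).ne')).mul
      (hF2 x hx).hasDerivAt
    convert! h1 using 1
    have h2 : F x ^ (-μ) = F x ^ (-μ - 1) * F x := by
      rw [← Real.rpow_add_one (hpos x hx).ne']; ring_nf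
    rw [h2]
    linear_combination -F x ^ (-μ - 1) * h x hx
  obtain ⟨c, hc⟩ := hI.exists_is_const_of_deriv_eq_zero hIc.isPreconnected
    (fun x hx => (hd x hx).differentiableAt.differentiableWithinAt) (fun x hx => (hd x hx).deriv)
  refine ⟨c, fun x hx => ?_⟩
  have h1 := hc x hx
  have h2 := Real.rpow_pos_of_pos (hpos x hx) μ
  rw [Real.rpow_neg (hpos x hx).le] at h1
  rw [← h1]
  field_simp

theorem eq_rpow_of_pos {I : Set ℝ} (hI : IsOpen I) (hIc : I.OrdConnected)
    {F : ℝ → ℝ} (hF : ContDiffOn ℝ ∞ F I) {μ : ℝ} (hμ : μ ≠ 1) (hpos : ∀ x ∈ I, 0 < F x)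
    (h : ∀ x ∈ I, F x * deriv (deriv F) x = μ * deriv F x ^ 2) :
    ∃ b d : ℝ, ∀ x ∈ I, 0 < b * x + d ∧ F x = (b * x + d) ^ (1 / (1 - μ)) := by
  have hF0 := (smooth_deriv_and_differentiableAt hI hF).2
  obtain ⟨c, hc⟩ := exists_deriv_eq_const_mul_rpow hI hIc hF hpos h
  have hμ' : 1 - μ ≠ 0 := sub_ne_zero.2 hμ.symm
  have hd : ∀ x ∈ I, HasDerivAt (fun x => F x ^ (1 - μ) - (1 - μ) * c * x) 0 x := by
    intro x hx
    have h1 := ((hF0 x hx).hasDerivAt.rpow_const (p := 1 - μ) (Or.inl (hpos x hx).ne')).sub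
      ((hasDerivAt_id x).const_mul ((1 - μ) * c))
    convert! h1 using 1
    rw [hc x hx]
    have h2 : F x ^ (1 - μ - 1) * F x ^ μ = 1 := by
      rw [← Real.rpow_add (hpos x hx)]; ring_nf; simp
    linear_combination -c * (1 - μ) * h2
  obtain ⟨d, hd'⟩ := hI.exists_is_const_of_deriv_eq_zero hIc.isPreconnected
    (fun x hx => (hd x hx).differentiableAt.differentiableWithinAt) (fun x hx => (hd x hx).deriv)
  refine ⟨(1 - μ) * c, d, fun x hx => ?_⟩
  have h1 : (1 - μ) * c * x + d = F x ^ (1 - μ) := by rw [← hd' x hx]; ring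
  rw [h1]
  refine ⟨Real.rpow_pos_of_pos (hpos x hx) _, ?_⟩
  rw [← Real.rpow_mul (hpos x hx).le, mul_one_div_cancel hμ', Real.rpow_one]

theorem eq_exp_of_pos {I : Set ℝ} (hI : IsOpen I) (hIc : I.OrdConnected)
    {F : ℝ → ℝ} (hF : ContDiffOn ℝ ∞ F I) (hpos : ∀ x ∈ I, 0 < F x)
    (h : ∀ x ∈ I, F x * deriv (deriv F) x = deriv F x ^ 2) :
    ∃ b d : ℝ, ∀ x ∈ I, F x = Real.exp (b * x + d) := by
  have hF0 := (smooth_deriv_and_differentiableAt hI hF).2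
  obtain ⟨c, hc⟩ := exists_deriv_eq_const_mul_rpow hI hIc hF (μ := 1) hpos (by simpa using h)
  have hd : ∀ x ∈ I, HasDerivAt (fun x => Real.log (F x) - c * x) 0 x := by
    intro x hx
    have h1 := ((hF0 x hx).hasDerivAt.log (hpos x hx).ne').sub ((hasDerivAt_id x).const_mul c)
    convert! h1 using 1
    rw [hc x hx, Real.rpow_one, mul_div_cancel_right₀ _ (hpos x hx).ne']
    ring
  obtain ⟨d, hd'⟩ := hI.exists_is_const_of_deriv_eq_zero hIc.isPreconnected
    (fun x hx => (hd x hx).differentiableAt.differentiableWithinAt) (fun x hx => (hd x hx).deriv)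
  refine ⟨c, d, fun x hx => ?_⟩
  rw [← hd' x hx, add_sub_cancel, Real.exp_log (hpos x hx)]

/-- A function `A (x - y)^r` on the right of `y` extends smoothly across `y` only if `r` is a
natural number: otherwise some derivative is unbounded. -/
theorem exists_nat_eq_of_smooth {I : Set ℝ} (hI : IsOpen I) {y x₀ : ℝ} (hy : y ∈ I)
    (hyx : y < x₀) (N : ℕ) : ∀ (r A : ℝ) (F : ℝ → ℝ), r < N → A ≠ 0 →
      ContDiffOn ℝ ∞ F I → (∀ x ∈ Ioo y x₀, F x = A * (x - y) ^ r) → ∃ n : ℕ, r = n := by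
  induction N with
  | zero =>
    intro r A F hr hA hF hFe
    exfalso
    have hr : r < 0 := by simpa using hr
    have hc : Filter.Tendsto F (nhdsWithin y (Ioi y)) (nhds (F y)) :=
      (hF.continuousOn.continuousAt (hI.mem_nhds hy)).tendsto.mono_left nhdsWithin_le_nhds
    have hsh : Filter.Tendsto (fun x => x - y) (nhdsWithin y (Ioi y)) (nhdsWithin 0 (Ioi 0)) := by
      refine tendsto_nhdsWithin_iff.2 ⟨?_, ?_⟩
      · have : Filter.Tendsto (fun x => x - y) (nhds y) (nhds (y - y)) :=
          (continuous_id.sub continuous_const).tendsto y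
        rw [sub_self] at this
        exact this.mono_left nhdsWithin_le_nhds
      · filter_upwards [self_mem_nhdsWithin] with x hx using sub_pos.2 (mem_Ioi.1 hx)
    have h1 := (tendsto_rpow_neg_nhdsGT_zero hr).comp hsh
    refine not_tendsto_nhds_of_tendsto_atTop h1 (F y / A) ((hc.div_const A).congr' ?_)
    filter_upwards [Ioo_mem_nhdsGT hyx] with x hx
    rw [hFe x hx]
    simp only [Function.comp_apply]
    field_simp
  | succ N ih =>
    intro r A F hr hA hF hFe
    by_cases hr0 : r = 0
    · exact ⟨0, by simpa using hr0⟩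
    · obtain ⟨n, hn⟩ := ih (r - 1) (A * r) (deriv F) (by push_cast at hr; linarith)
        (mul_ne_zero hA hr0) (smooth_deriv_and_differentiableAt hI hF).1 (by
          intro x hx
          have h1 : F =ᶠ[nhds x] fun x => A * (x - y) ^ r := by
            filter_upwards [isOpen_Ioo.mem_nhds hx] with x hx using hFe x hx
          have h2 := ((((hasDerivAt_id x).sub_const y).rpow_const (p := r)
            (Or.inl (sub_pos.2 hx.1).ne')).const_mul A).congr_of_eventuallyEq h1
          rw [h2.deriv]
          simp only [id]
          ring)
      exact ⟨n + 1, by push_cast; linarith⟩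

/-- Higher derivatives of a solution of `f f'' = μ f'²`. -/
theorem pow_mul_iteratedDeriv_succ {I : Set ℝ} (hI : IsOpen I) {f : ℝ → ℝ}
    (hf : ContDiffOn ℝ ∞ f I) {μ : ℝ}
    (h : ∀ x ∈ I, f x * deriv (deriv f) x = μ * deriv f x ^ 2) (k : ℕ) :
    ∀ x ∈ I, f x ^ k * iteratedDeriv (k + 1) f x =
      (∏ j ∈ Finset.range k, (((j : ℝ) + 1) * μ - j)) * deriv f x ^ (k + 1) := by
  obtain ⟨hf1, hf0⟩ := smooth_deriv_and_differentiableAt hI hf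
  have hf2 := (smooth_deriv_and_differentiableAt hI hf1).2
  induction k with
  | zero => intro x _; simp [iteratedDeriv_one]
  | succ k ih =>
    intro x hx
    set C := ∏ j ∈ Finset.range k, (((j : ℝ) + 1) * μ - j) with hC
    have hd := (smooth_deriv_and_differentiableAt hI (smooth_iteratedDeriv hI hf (k + 1))).2 x hx
    have h1 := ((hf0 x hx).hasDerivAt.pow k).mul hd.hasDerivAt
    have h2 : (fun x => f x ^ k * iteratedDeriv (k + 1) f x) =ᶠ[nhds x]
        fun x => C * deriv f x ^ (k + 1) := by
      filter_upwards [hI.mem_nhds hx] with x hx using ih x hx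
    have h3 := h1.unique ((((hf2 x hx).hasDerivAt.pow (k + 1)).const_mul C).congr_of_eventuallyEq h2)
    rw [← iteratedDeriv_succ] at h3
    simp only [Pi.pow_apply, Nat.add_sub_cancel, Nat.cast_add, Nat.cast_one] at h3
    rw [Finset.prod_range_succ, ← hC]
    have h4 : (k : ℝ) * f x ^ (k - 1) * f x = k * f x ^ k := by
      cases k with
      | zero => simp
      | succ k => simp only [Nat.add_sub_cancel]; ring
    linear_combination f x * h3 - deriv f x * iteratedDeriv (k + 1) f x * h4 -
      (k : ℝ) * deriv f x * ih x hx + C * ((k : ℝ) + 1) * deriv f x ^ k * h x hx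

/-- A function with vanishing derivative of order `n + 1` which agrees with `A (x - y)^n` on a
subinterval agrees with it everywhere. -/
theorem eq_pow_of_iteratedDeriv_eq_zero {I : Set ℝ} (hI : IsOpen I) (hIc : I.OrdConnected)
    {V : Set ℝ} (hV : IsOpen V) (hVn : V.Nonempty) (hVI : V ⊆ I) (y : ℝ) (n : ℕ) :
    ∀ (A : ℝ) (f : ℝ → ℝ), ContDiffOn ℝ ∞ f I → (∀ x ∈ I, iteratedDeriv (n + 1) f x = 0) →
      (∀ x ∈ V, f x = A * (x - y) ^ n) → ∀ x ∈ I, f x = A * (x - y) ^ n := by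
  obtain ⟨v, hv⟩ := hVn
  induction n with
  | zero =>
    intro A f hf h0 hfV x hx
    have hf0 := (smooth_deriv_and_differentiableAt hI hf).2
    have h1 : f x = f v := hI.is_const_of_deriv_eq_zero hIc.isPreconnected
      (fun x hx => (hf0 x hx).differentiableWithinAt)
      (fun x hx => by simpa [iteratedDeriv_one] using h0 x hx) hx (hVI hv)
    rw [h1, hfV v hv]
    simp
  | succ n ih =>
    intro A f hf h0 hfV x hx
    obtain ⟨hf1, hf0⟩ := smooth_deriv_and_differentiableAt hI hf
    have hpd : ∀ x, HasDerivAt (fun x => A * (x - y) ^ (n + 1))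
        (A * ((n + 1 : ℕ) : ℝ) * (x - y) ^ n) x := by
      intro x
      convert! (((hasDerivAt_id x).sub_const y).pow (n + 1)).const_mul A using 1
      simp
      ring
    have h1 := ih (A * ((n + 1 : ℕ) : ℝ)) (deriv f) hf1
      (fun x hx => by rw [← iteratedDeriv_succ']; exact h0 x hx) (by
        intro x hx
        refine ((hpd x).congr_of_eventuallyEq ?_).deriv
        filter_upwards [hV.mem_nhds hx] with x hx using hfV x hx)
    have hd : ∀ x ∈ I, HasDerivAt (fun x => f x - A * (x - y) ^ (n + 1)) 0 x := by
      intro x hx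
      convert! (hf0 x hx).hasDerivAt.sub (hpd x) using 1
      rw [h1 x hx, sub_self]
    have h2 : f x - A * (x - y) ^ (n + 1) = f v - A * (v - y) ^ (n + 1) :=
      hI.is_const_of_deriv_eq_zero (f := fun x => f x - A * (x - y) ^ (n + 1)) hIc.isPreconnected
      (fun x hx => (hd x hx).differentiableAt.differentiableWithinAt)
      (fun x hx => (hd x hx).deriv) hx (hVI hv)
    rw [hfV v hv, sub_self] at h2
    linarith

/-- A solution of `f f'' = μ f'²` with a zero on the left of a point where it does not vanish
is a monomial. -/
theorem eq_monomial_of_zero_of_lt {I : Set ℝ} (hI : IsOpen I) (hIc : I.OrdConnected) {f : ℝ → ℝ}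
    (hf : ContDiffOn ℝ ∞ f I) {μ : ℝ}
    (h : ∀ x ∈ I, f x * deriv (deriv f) x = μ * deriv f x ^ 2) {x₁ x₀ : ℝ} (hx₁ : x₁ ∈ I)
    (hx₀ : x₀ ∈ I) (hlt : x₁ < x₀) (hz : f x₁ = 0) (hnz : f x₀ ≠ 0) :
    μ ≠ 1 ∧ ∃ (n : ℕ) (A y : ℝ), 1 / (1 - μ) = n ∧ n ≠ 0 ∧ A ≠ 0 ∧
      ∀ x ∈ I, f x = A * (x - y) ^ n := by
  have hIcc : Icc x₁ x₀ ⊆ I := hIc.out hx₁ hx₀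
  -- the last zero before `x₀`
  obtain ⟨y, ⟨hyI, hy0⟩, hymax⟩ : ∃ y, IsGreatest (Icc x₁ x₀ ∩ f ⁻¹' {0}) y := by
    refine IsCompact.exists_isGreatest ?_ ⟨x₁, left_mem_Icc.2 hlt.le, hz⟩
    exact isCompact_Icc.of_isClosed_subset
      ((hf.continuousOn.mono hIcc).preimage_isClosed_of_isClosed isClosed_Icc isClosed_singleton)
      inter_subset_left
  have hy0 : f y = 0 := hy0
  have hyx : y < x₀ := lt_of_le_of_ne hyI.2 fun h0 => hnz (h0 ▸ hy0)
  have hsub : Ioo y x₀ ⊆ I := fun x hx => hIcc ⟨hyI.1.trans hx.1.le, hx.2.le⟩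
  have hne : ∀ x ∈ Ioo y x₀, f x ≠ 0 := fun x hx h0 =>
    absurd (hymax ⟨⟨hyI.1.trans hx.1.le, hx.2.le⟩, h0⟩) (not_le.2 hx.1)
  have hyI' : y ∈ I := hIcc hyI
  have hfJ := hf.mono hsub
  obtain ⟨σ, hσ, hpos⟩ := sign_const_of_ne_zero ordConnected_Ioo hfJ.continuousOn hne
  have hσ0 : σ ≠ 0 := by rcases hσ with rfl | rfl <;> norm_num
  have hσ2 : σ * σ = 1 := by rcases hσ with rfl | rfl <;> norm_num
  have hF : ContDiffOn ℝ ∞ (fun x => σ * f x) (Ioo y x₀) := contDiffOn_const.mul hfJ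
  have hdσ : deriv (fun x => σ * f x) = fun x => σ * deriv f x := by
    funext x; exact deriv_const_mul_field σ
  have hF' : ∀ x ∈ Ioo y x₀, (σ * f x) * deriv (deriv fun x => σ * f x) x =
      μ * deriv (fun x => σ * f x) x ^ 2 := by
    intro x hx
    have hdσ' : deriv (fun x => σ * deriv f x) x = σ * deriv (deriv f) x :=
      deriv_const_mul_field σ
    rw [hdσ]
    simp only
    rw [hdσ']
    linear_combination σ ^ 2 * h x (hsub hx)
  -- the explicit formula on the right of `y` has to tend to `f y = 0`
  have hlim : ∀ G : ℝ → ℝ, ContinuousAt G y → (∀ x ∈ Ioo y x₀, σ * f x = G x) → G y = 0 := by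
    intro G hG hGe
    have h1 : Filter.Tendsto (fun x => σ * f x) (nhdsWithin y (Ioi y)) (nhds (σ * f y)) :=
      ((hf.continuousOn.continuousAt (hI.mem_nhds hyI')).tendsto.mono_left
        nhdsWithin_le_nhds).const_mul σ
    have h2 : Filter.Tendsto (fun x => σ * f x) (nhdsWithin y (Ioi y)) (nhds (G y)) := by
      refine (hG.tendsto.mono_left nhdsWithin_le_nhds).congr' ?_
      filter_upwards [Ioo_mem_nhdsGT hyx] with x hx using (hGe x hx).symm
    have h3 := tendsto_nhds_unique h1 h2
    rw [hy0, mul_zero] at h3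
    exact h3.symm
  have hμ : μ ≠ 1 := by
    rintro rfl
    obtain ⟨b, d, hbd⟩ := eq_exp_of_pos isOpen_Ioo ordConnected_Ioo hF hpos (by simpa using hF')
    exact (Real.exp_pos _).ne' (hlim (fun x => Real.exp (b * x + d)) (by fun_prop) hbd)
  refine ⟨hμ, ?_⟩
  obtain ⟨b, d, hbd⟩ := eq_rpow_of_pos isOpen_Ioo ordConnected_Ioo hF hμ hpos hF'
  set m := 1 / (1 - μ) with hm
  have hm0 : m ≠ 0 := one_div_ne_zero (sub_ne_zero.2 hμ.symm)
  have hby : b * y + d = 0 := by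
    have hge : 0 ≤ b * y + d := by
      have hc : Filter.Tendsto (fun x => b * x + d) (nhdsWithin y (Ioi y)) (nhds (b * y + d)) :=
        (Continuous.tendsto (by fun_prop) y).mono_left nhdsWithin_le_nhds
      refine ge_of_tendsto hc ?_
      filter_upwards [Ioo_mem_nhdsGT hyx] with x hx using (hbd x hx).1.le
    by_contra h0
    have hgt : 0 < b * y + d := lt_of_le_of_ne hge (Ne.symm h0)
    refine (Real.rpow_pos_of_pos hgt m).ne' (hlim (fun x => (b * x + d) ^ m) ?_
      fun x hx => (hbd x hx).2)
    exact ContinuousAt.rpow_const (by fun_prop) (Or.inl h0)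
  have hbx : ∀ x, b * x + d = b * (x - y) := fun x => by linear_combination hby
  obtain ⟨z, hz⟩ : (Ioo y x₀).Nonempty := nonempty_Ioo.2 hyx
  have hb : 0 < b := by
    have h1 := (hbd z hz).1
    rw [hbx] at h1
    exact pos_of_mul_pos_left h1 (sub_pos.2 hz.1).le
  have hform : ∀ x ∈ Ioo y x₀, f x = σ * b ^ m * (x - y) ^ m := by
    intro x hx
    have h1 := (hbd x hx).2
    rw [hbx, Real.mul_rpow hb.le (sub_pos.2 hx.1).le] at h1
    linear_combination σ * h1 - f x * hσ2
  have hA : σ * b ^ m ≠ 0 := mul_ne_zero hσ0 (Real.rpow_pos_of_pos hb m).ne'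
  obtain ⟨N, hN⟩ := exists_nat_gt m
  obtain ⟨n, hn⟩ := exists_nat_eq_of_smooth hI hyI' hyx N m _ f hN hA hf hform
  have hn0 : n ≠ 0 := by
    rintro rfl
    exact hm0 (by simpa using hn)
  refine ⟨n, σ * b ^ m, y, hn, hn0, hA, ?_⟩
  -- the derivative of order `n + 1` vanishes on the dense set where `f ≠ 0` or `f = 0` locally
  have hder : ∀ x ∈ I, iteratedDeriv (n + 1) f x = 0 := by
    have hprod : ∏ j ∈ Finset.range n, (((j : ℝ) + 1) * μ - j) = 0 := by
      refine Finset.prod_eq_zero (i := n - 1) (Finset.mem_range.2 (by omega)) ?_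
      have h1 : ((n - 1 : ℕ) : ℝ) = n - 1 := by
        rw [Nat.cast_sub (by omega)]; simp
      have h2 : (n : ℝ) * (1 - μ) = 1 := by
        rw [← hn, hm, one_div, inv_mul_cancel₀ (sub_ne_zero.2 hμ.symm)]
      rw [h1]
      linear_combination -h2
    have hne0 : ∀ x ∈ I, f x ≠ 0 → iteratedDeriv (n + 1) f x = 0 := by
      intro x hx h0
      have h1 := pow_mul_iteratedDeriv_succ hI hf h n x hx
      rw [hprod, zero_mul] at h1
      exact (mul_eq_zero.1 h1).resolve_left (pow_ne_zero n h0)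
    intro x hx
    by_contra h0
    have h1 : ∀ᶠ x in nhds x, iteratedDeriv (n + 1) f x ≠ 0 :=
      ((smooth_iteratedDeriv hI hf (n + 1)).continuousOn.continuousAt
        (hI.mem_nhds hx)).eventually_ne h0
    have h2 : f =ᶠ[nhds x] fun _ => 0 := by
      filter_upwards [h1, hI.mem_nhds hx] with x hx1 hx2
      by_contra h3
      exact hx1 (hne0 x hx2 h3)
    apply h0
    rw [h2.iteratedDeriv_eq]
    simp
  refine eq_pow_of_iteratedDeriv_eq_zero hI hIc isOpen_Ioo ⟨z, hz⟩ hsub y n _ f hf hder ?_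
  intro x hx
  rw [hform x hx, hn]
  simp only [Real.rpow_natCast]

/-- A solution of `f f'' = μ f'²` with a zero is a monomial, unless it vanishes identically. -/
theorem eq_monomial_of_zero {I : Set ℝ} (hI : IsOpen I) (hIc : I.OrdConnected) {f : ℝ → ℝ}
    (hf : ContDiffOn ℝ ∞ f I) {μ : ℝ}
    (h : ∀ x ∈ I, f x * deriv (deriv f) x = μ * deriv f x ^ 2) {x₁ x₀ : ℝ} (hx₁ : x₁ ∈ I)
    (hx₀ : x₀ ∈ I) (hz : f x₁ = 0) (hnz : f x₀ ≠ 0) :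
    μ ≠ 1 ∧ ∃ (n : ℕ) (A y : ℝ), 1 / (1 - μ) = n ∧ n ≠ 0 ∧ A ≠ 0 ∧
      ∀ x ∈ I, f x = A * (x - y) ^ n := by
  rcases lt_trichotomy x₁ x₀ with hlt | heq | hgt
  · exact eq_monomial_of_zero_of_lt hI hIc hf h hx₁ hx₀ hlt hz hnz
  · exact absurd (heq ▸ hz) hnz
  · have hd : deriv (fun x => f (-x)) = fun x => -deriv f (-x) := by
      funext x; exact deriv_comp_neg f x
    have hd2 : ∀ x, deriv (fun x => -deriv f (-x)) x = deriv (deriv f) (-x) := by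
      intro x
      rw [deriv.fun_neg, deriv_comp_neg (deriv f) x, neg_neg]
    obtain ⟨hμ, n, A, y, hn, hn0, hA, hform⟩ := eq_monomial_of_zero_of_lt (I := Neg.neg ⁻¹' I)
      (f := fun x => f (-x)) (μ := μ) (x₁ := -x₁) (x₀ := -x₀) (hI.preimage continuous_neg)
      (hIc.preimage_anti fun a b hab => neg_le_neg hab)
      (hf.comp contDiff_neg.contDiffOn fun x hx => hx) (by
        intro x hx
        rw [hd]
        simp only
        rw [hd2, h (-x) hx, neg_sq]) (by simpa using hx₁) (by simpa using hx₀) (by linarith)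
      (by simpa using hz) (by simpa using hnz)
    refine ⟨hμ, n, A * (-1) ^ n, -y, hn, hn0, mul_ne_zero hA (by simp), fun x hx => ?_⟩
    have h1 := hform (-x) (by simpa using hx)
    rw [neg_neg] at h1
    rw [h1, mul_assoc, ← mul_pow]
    congr 2
    ring

/-- The non-constant solutions of `f f'' = μ f'²` for `μ ≠ 1`. -/
theorem exists_eq_rpow {I : Set ℝ} (hI : IsOpen I) (hIc : I.OrdConnected) {f : ℝ → ℝ}
    (hf : ContDiffOn ℝ ∞ f I) {μ : ℝ} (hμ1 : μ ≠ 1)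
    (h : ∀ x ∈ I, f x * deriv (deriv f) x = μ * deriv f x ^ 2) {x₀ : ℝ} (hx₀ : x₀ ∈ I)
    (hnz : f x₀ ≠ 0) (hd : deriv f x₀ ≠ 0) :
    ∃ σ b d : ℝ, (σ = 1 ∨ σ = -1) ∧ b ≠ 0 ∧ ∀ x ∈ I, PowDefined (b * x + d) (1 / (1 - μ)) ∧
      f x = σ * (b * x + d) ^ (1 / (1 - μ)) := by
  by_cases hz : ∃ x ∈ I, f x = 0
  · obtain ⟨x₁, hx₁, hz⟩ := hz
    obtain ⟨-, n, A, y, hn, hn0, hA, hform⟩ := eq_monomial_of_zero hI hIc hf h hx₁ hx₀ hz hnz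
    have hA' : 0 < |A| := abs_pos.2 hA
    obtain ⟨σ, hσ, hσA⟩ : ∃ σ : ℝ, (σ = 1 ∨ σ = -1) ∧ A = σ * |A| := by
      rcases abs_choice A with h1 | h1
      · exact ⟨1, Or.inl rfl, by rw [h1, one_mul]⟩
      · exact ⟨-1, Or.inr rfl, by rw [h1]; ring⟩
    -- the leading coefficient is absorbed into the base of the power
    refine ⟨σ, |A| ^ (1 / n : ℝ), -(|A| ^ (1 / n : ℝ) * y), hσ,
      (Real.rpow_pos_of_pos hA' _).ne', fun x hx => ?_⟩
    rw [hn]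
    refine ⟨Or.inr (Or.inl ⟨n, rfl⟩), ?_⟩
    have h1 : |A| ^ (1 / n : ℝ) * x + -(|A| ^ (1 / n : ℝ) * y) = |A| ^ (1 / n : ℝ) * (x - y) := by
      ring
    have h2 : (|A| ^ (1 / n : ℝ)) ^ n = |A| := by
      rw [← Real.rpow_natCast, ← Real.rpow_mul hA'.le, one_div_mul_cancel (by exact_mod_cast hn0),
        Real.rpow_one]
    rw [h1, Real.rpow_natCast, mul_pow, h2, hform x hx, ← mul_assoc, ← hσA]
  · push Not at hz
    obtain ⟨σ, hσ, hpos⟩ := sign_const_of_ne_zero hIc hf.continuousOn hz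
    have hσ2 : σ * σ = 1 := by rcases hσ with rfl | rfl <;> norm_num
    have hdσ : deriv (fun x => σ * f x) = fun x => σ * deriv f x := by
      funext x; exact deriv_const_mul_field σ
    obtain ⟨b, d, hbd⟩ := eq_rpow_of_pos hI hIc (F := fun x => σ * f x) (contDiffOn_const.mul hf)
      hμ1 hpos (by
        intro x hx
        have hdσ' : deriv (fun x => σ * deriv f x) x = σ * deriv (deriv f) x :=
          deriv_const_mul_field σ
        rw [hdσ]
        simp only
        rw [hdσ']
        linear_combination σ ^ 2 * h x hx)
    have hform : ∀ x ∈ I, f x = σ * (b * x + d) ^ (1 / (1 - μ)) := by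
      intro x hx
      rw [← (hbd x hx).2, ← mul_assoc, hσ2, one_mul]
    refine ⟨σ, b, d, hσ, ?_, fun x hx => ⟨Or.inl (hbd x hx).1, hform x hx⟩⟩
    rintro rfl
    apply hd
    have h1 : f =ᶠ[nhds x₀] fun _ => σ * d ^ (1 / (1 - μ)) := by
      filter_upwards [hI.mem_nhds hx₀] with x hx
      simpa using hform x hx
    exact ((hasDerivAt_const x₀ _).congr_of_eventuallyEq h1).deriv

/-- The non-constant solutions of `f f'' = f'²`. -/
theorem exists_eq_exp {I : Set ℝ} (hI : IsOpen I) (hIc : I.OrdConnected) {f : ℝ → ℝ}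
    (hf : ContDiffOn ℝ ∞ f I) (h : ∀ x ∈ I, f x * deriv (deriv f) x = deriv f x ^ 2) {x₀ : ℝ}
    (hx₀ : x₀ ∈ I) (hnz : f x₀ ≠ 0) (hd : deriv f x₀ ≠ 0) :
    ∃ A b : ℝ, A ≠ 0 ∧ b ≠ 0 ∧ ∀ x ∈ I, f x = A * Real.exp (b * x) := by
  have hz : ∀ x ∈ I, f x ≠ 0 := fun x hx hz =>
    (eq_monomial_of_zero hI hIc hf (μ := 1) (by simpa using h) hx hx₀ hz hnz).1 rfl
  obtain ⟨σ, hσ, hpos⟩ := sign_const_of_ne_zero hIc hf.continuousOn hz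
  have hσ0 : σ ≠ 0 := by rcases hσ with rfl | rfl <;> norm_num
  have hσ2 : σ * σ = 1 := by rcases hσ with rfl | rfl <;> norm_num
  have hdσ : deriv (fun x => σ * f x) = fun x => σ * deriv f x := by
    funext x; exact deriv_const_mul_field σ
  obtain ⟨b, d, hbd⟩ := eq_exp_of_pos hI hIc (F := fun x => σ * f x) (contDiffOn_const.mul hf)
    hpos (by
      intro x hx
      have hdσ' : deriv (fun x => σ * deriv f x) x = σ * deriv (deriv f) x :=
        deriv_const_mul_field σ
      rw [hdσ]
      simp only
      rw [hdσ']
      linear_combination σ ^ 2 * h x hx)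
  have hform : ∀ x ∈ I, f x = σ * Real.exp d * Real.exp (b * x) := by
    intro x hx
    rw [mul_assoc, ← Real.exp_add, add_comm d, ← hbd x hx, ← mul_assoc, hσ2, one_mul]
  refine ⟨σ * Real.exp d, b, mul_ne_zero hσ0 (Real.exp_pos d).ne', ?_, hform⟩
  rintro rfl
  apply hd
  have h1 : f =ᶠ[nhds x₀] fun _ => σ * Real.exp d := by
    filter_upwards [hI.mem_nhds hx₀] with x hx
    simpa using hform x hx
  exact ((hasDerivAt_const x₀ _).congr_of_eventuallyEq h1).deriv

/-! ### Homothetical surfaces -/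

/-- The three types of homothetical surfaces are `(s, t) ↦ s e_i + t e_j + f(s) g(t) e_k` for
three choices of distinct indices. -/
theorem IsHomotheticalSurface.exists_eq {I J : Set ℝ} {f g : ℝ → ℝ} {X : ℝ × ℝ → L3}
    (h : IsHomotheticalSurface I J f g X) : ∃ i j k : Fin 3,
      ((i, j, k) = (0, 1, 2) ∨ (i, j, k) = (1, 2, 0) ∨ (i, j, k) = (0, 2, 1)) ∧
      X = fun p => p.1 • (Pi.single i 1 : L3) + p.2 • (Pi.single j 1 : L3) +
        (f p.1 * g p.2) • (Pi.single k 1 : L3) := by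
  rcases h.eq_graph with h1 | h1 | h1
  · refine ⟨0, 1, 2, Or.inl rfl, h1.trans (funext fun p => funext fun l => ?_)⟩
    fin_cases l <;> simp
  · refine ⟨1, 2, 0, Or.inr (Or.inl rfl), h1.trans (funext fun p => funext fun l => ?_)⟩
    fin_cases l <;> simp
  · refine ⟨0, 2, 1, Or.inr (Or.inr rfl), h1.trans (funext fun p => funext fun l => ?_)⟩
    fin_cases l <;> simp

/-- The Gauss equation of a homothetical surface. -/
theorem IsHomotheticalSurface.gauss {I J : Set ℝ} {f g : ℝ → ℝ} {X : ℝ × ℝ → L3}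
    (h : IsHomotheticalSurface I J f g X) (hX : IsNondegenerateOn (I ×ˢ J) X) :
    ∃ ε₁ ε₂ : ℝ, ε₁ ^ 2 = 1 ∧ ε₂ ^ 2 = 1 ∧ ∀ x ∈ I, ∀ y ∈ J,
      1 + ε₁ * deriv f x ^ 2 * g y ^ 2 + ε₂ * f x ^ 2 * deriv g y ^ 2 ≠ 0 ∧
      gaussK X (x, y) *
          (1 + ε₁ * deriv f x ^ 2 * g y ^ 2 + ε₂ * f x ^ 2 * deriv g y ^ 2) ^ 2 =
        deriv f x ^ 2 * deriv g y ^ 2 -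
          f x * deriv (deriv f) x * (g y * deriv (deriv g) y) := by
  obtain ⟨i, j, k, hijk, hXe⟩ := h.exists_eq
  have hline : ∀ i : Fin 3, ContDiff ℝ ∞ fun s : ℝ => s • (Pi.single i 1 : L3) :=
    fun i => contDiff_id.smul contDiff_const
  have hd1 : ∀ i : Fin 3, deriv (fun s : ℝ => s • (Pi.single i 1 : L3)) =
      fun _ => Pi.single i 1 := by
    intro i
    funext s
    simpa using ((hasDerivAt_id s).smul_const (Pi.single i 1 : L3)).deriv
  have hp : ∀ x ∈ I, ∀ y ∈ J, _ := fun x hx y hy =>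
    partials_separated h.interval_left.1 h.interval_right.1 (Pi.single k 1 : L3)
      (hline i).contDiffOn (hline j).contDiffOn h.smooth_left h.smooth_right hXe hx hy
  simp only [hd1, deriv_const, zero_add] at hp
  have hW0 : ∀ x ∈ I, ∀ y ∈ J, gramDet X (x, y) ≠ 0 := fun x hx y hy =>
    gramDet_ne_zero hX (mk_mem_prod hx hy)
  have hG : ∀ x ∈ I, ∀ y ∈ J, gramDet X (x, y) ≠ 0 ∧ _ := fun x hx y hy =>
    ⟨hW0 x hx y hy, gaussK_mul_gramDet_sq (hW0 x hx y hy)⟩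
  rcases hijk with hijk | hijk | hijk <;> simp only [Prod.mk.injEq] at hijk <;>
    obtain ⟨rfl, rfl, rfl⟩ := hijk
  · refine ⟨-1, -1, by norm_num, by norm_num, fun x hx y hy => ?_⟩
    obtain ⟨h1, h2, h3, h4, h5⟩ := hp x hx y hy
    obtain ⟨hW, hK⟩ := hG x hx y hy
    simp [gramDet, coeffE, coeffF, coeffG, h1, h2, h3, h4, h5, lprod,
      lcross] at hW hK
    refine ⟨fun h0 => hW ?_, ?_⟩
    · linear_combination h0
    · linear_combination hK
  · refine ⟨1, -1, by norm_num, by norm_num, fun x hx y hy => ?_⟩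
    obtain ⟨h1, h2, h3, h4, h5⟩ := hp x hx y hy
    obtain ⟨hW, hK⟩ := hG x hx y hy
    simp [gramDet, coeffE, coeffF, coeffG, h1, h2, h3, h4, h5, lprod,
      lcross] at hW hK
    refine ⟨fun h0 => hW ?_, ?_⟩
    · linear_combination -h0
    · linear_combination hK
  · refine ⟨1, -1, by norm_num, by norm_num, fun x hx y hy => ?_⟩
    obtain ⟨h1, h2, h3, h4, h5⟩ := hp x hx y hy
    obtain ⟨hW, hK⟩ := hG x hx y hy
    simp [gramDet, coeffE, coeffF, coeffG, h1, h2, h3, h4, h5, lprod,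
      lcross] at hW hK
    refine ⟨fun h0 => hW ?_, ?_⟩
    · linear_combination -h0
    · linear_combination hK

theorem IsHomotheticalSurface.isCoordinateCylinder_of_left {I J : Set ℝ} {f g : ℝ → ℝ}
    {X : ℝ × ℝ → L3} (h : IsHomotheticalSurface I J f g X) (hX : IsNondegenerateOn (I ×ˢ J) X)
    {c : ℝ} (hf : ∀ x ∈ I, f x = c) : IsCoordinateCylinder (I ×ˢ J) X := by
  obtain ⟨i, j, k, hijk, hXe⟩ := h.exists_eq
  have hne : i ≠ j ∧ i ≠ k := by
    rcases hijk with hijk | hijk | hijk <;> simp only [Prod.mk.injEq] at hijk <;>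
      obtain ⟨rfl, rfl, rfl⟩ := hijk <;> decide
  refine ⟨i, isCylindricalAlong_of_eq (h.interval_left.1.prod h.interval_right.1) hX
    h.interval_right.1
    (γ := fun t => t • (Pi.single j 1 : L3) + (c * g t) • (Pi.single k 1 : L3)) ?_ ?_
    (ψ := fun q => (q.2, q.1)) (contDiff_snd.prodMk contDiff_fst).contDiffOn (fun q hq => hq.2) ?_⟩
  · exact (contDiff_id.smul contDiff_const).contDiffOn.add
      ((contDiffOn_const.mul h.smooth_right).smul contDiffOn_const)
  · intro t _
    simp [hne.1, hne.2]
  · intro q hq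
    rw [hXe]
    simp only [hf q.1 hq.1]
    abel

theorem IsHomotheticalSurface.isCoordinateCylinder_of_right {I J : Set ℝ} {f g : ℝ → ℝ}
    {X : ℝ × ℝ → L3} (h : IsHomotheticalSurface I J f g X) (hX : IsNondegenerateOn (I ×ˢ J) X)
    {c : ℝ} (hg : ∀ y ∈ J, g y = c) : IsCoordinateCylinder (I ×ˢ J) X := by
  obtain ⟨i, j, k, hijk, hXe⟩ := h.exists_eq
  have hne : j ≠ i ∧ j ≠ k := by
    rcases hijk with hijk | hijk | hijk <;> simp only [Prod.mk.injEq] at hijk <;>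
      obtain ⟨rfl, rfl, rfl⟩ := hijk <;> decide
  refine ⟨j, isCylindricalAlong_of_eq (h.interval_left.1.prod h.interval_right.1) hX
    h.interval_left.1
    (γ := fun s => s • (Pi.single i 1 : L3) + (f s * c) • (Pi.single k 1 : L3)) ?_ ?_
    (ψ := fun q => q) contDiff_id.contDiffOn (fun q hq => hq.1) ?_⟩
  · exact (contDiff_id.smul contDiff_const).contDiffOn.add
      ((h.smooth_left.mul contDiffOn_const).smul contDiffOn_const)
  · intro t _
    simp [hne.1, hne.2]
  · intro q hq
    rw [hXe]
    simp only [hg q.2 hq.2]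
    abel

/-- The solutions of the equation `f f'' g g'' = f'² g'²` of flat graphs, for non-constant `f` and
`g`. The variables separate into `f f'' = μ f'²` and `g g'' = μ⁻¹ g'²`. -/
theorem exponential_or_power_of_flat {I J : Set ℝ} (hI : IsOpenInterval I)
    (hJ : IsOpenInterval J) {f g : ℝ → ℝ} (hf : ContDiffOn ℝ ∞ f I) (hg : ContDiffOn ℝ ∞ g J)
    (h : ∀ x ∈ I, ∀ y ∈ J, deriv f x ^ 2 * deriv g y ^ 2 =
      f x * deriv (deriv f) x * (g y * deriv (deriv g) y))
    {x₀ y₀ : ℝ} (hx₀ : x₀ ∈ I) (hy₀ : y₀ ∈ J) (hfx : deriv f x₀ ≠ 0) (hgy : deriv g y₀ ≠ 0) :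
    IsExponentialForm I J (fun x y => f x * g y) ∨ IsPowerForm I J (fun x y => f x * g y) := by
  have hne : f x₀ * deriv (deriv f) x₀ * (g y₀ * deriv (deriv g) y₀) ≠ 0 := by
    rw [← h x₀ hx₀ y₀ hy₀]
    exact mul_ne_zero (pow_ne_zero 2 hfx) (pow_ne_zero 2 hgy)
  have hf0 : f x₀ * deriv (deriv f) x₀ ≠ 0 := left_ne_zero_of_mul hne
  have hg0 : g y₀ * deriv (deriv g) y₀ ≠ 0 := right_ne_zero_of_mul hne
  have hfx' : f x₀ ≠ 0 := left_ne_zero_of_mul hf0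
  have hgy' : g y₀ ≠ 0 := left_ne_zero_of_mul hg0
  set μ := deriv g y₀ ^ 2 / (g y₀ * deriv (deriv g) y₀) with hμ
  have hμ0 : μ ≠ 0 := div_ne_zero (pow_ne_zero 2 hgy) hg0
  have hfμ : ∀ x ∈ I, f x * deriv (deriv f) x = μ * deriv f x ^ 2 := by
    intro x hx
    rw [hμ, div_mul_eq_mul_div, eq_div_iff hg0]
    linear_combination -h x hx y₀ hy₀
  have hgμ : ∀ y ∈ J, g y * deriv (deriv g) y = μ⁻¹ * deriv g y ^ 2 := by
    intro y hy
    have h1 := h x₀ hx₀ y hy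
    rw [hfμ x₀ hx₀] at h1
    have h2 : deriv g y ^ 2 = μ * (g y * deriv (deriv g) y) :=
      mul_left_cancel₀ (pow_ne_zero 2 hfx) (by linear_combination h1)
    rw [h2, inv_mul_cancel_left₀ hμ0]
  by_cases hμ1 : μ = 1
  · left
    rw [hμ1] at hfμ hgμ
    obtain ⟨A, b, hA, hb, h1⟩ := exists_eq_exp hI.1 hI.2.1 hf
      (fun x hx => by simpa using hfμ x hx) hx₀ hfx' hfx
    obtain ⟨B, c, hB, hc, h2⟩ := exists_eq_exp hJ.1 hJ.2.1 hg
      (fun x hx => by simpa using hgμ x hx) hy₀ hgy' hgy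
    refine ⟨A * B, b, c, mul_ne_zero hA hB, hb, hc, fun x hx y hy => ?_⟩
    simp only
    rw [h1 x hx, h2 y hy, Real.exp_add]
    ring
  · right
    have h1μ : 1 - μ ≠ 0 := sub_ne_zero.2 (Ne.symm hμ1)
    obtain ⟨σ, b, d, hσ, hb, h1⟩ := exists_eq_rpow hI.1 hI.2.1 hf hμ1 hfμ hx₀ hfx' hfx
    obtain ⟨σ', c, e, hσ', hc, h2⟩ := exists_eq_rpow hJ.1 hJ.2.1 hg
      (by simpa using hμ1) hgμ hy₀ hgy' hgy
    set m := 1 / (1 - μ) with hm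
    have hm0 : m ≠ 0 := one_div_ne_zero h1μ
    -- the two exponents add up to one
    have hm' : 1 / (1 - μ⁻¹) = 1 - m := by
      have h3 : 1 - μ⁻¹ ≠ 0 := by
        rw [sub_ne_zero]
        intro h0
        exact hμ1 (by rw [← inv_inv μ, ← h0, inv_one])
      have h4 : 1 - μ⁻¹ = -(1 - μ) / μ := by field_simp; ring
      rw [h4, hm]
      field_simp
      ring
    have hm1 : m ≠ 1 := by
      intro h0
      rw [hm, div_eq_one_iff_eq h1μ] at h0
      exact hμ0 (by linarith)
    have hm1' : m - 1 ≠ 0 := sub_ne_zero.2 hm1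
    rw [hm'] at h2
    have e1 : ∀ x, b * m * x / m + d = b * x + d := fun x => by field_simp
    have e2 : ∀ y, c * (m - 1) * y / (m - 1) + e = c * y + e := fun y => by field_simp
    refine ⟨σ * σ', b * m, c * (m - 1), d, e, m, ?_, mul_ne_zero hb hm0, mul_ne_zero hc hm1', hm0,
      hm1, fun x hx => ?_, fun y hy => ?_, fun x hx y hy => ?_⟩
    · rcases hσ with rfl | rfl <;> rcases hσ' with rfl | rfl <;> norm_num
    · rw [e1]; exact (h1 x hx).1
    · rw [e2]; exact (h2 y hy).1
    · rw [e1, e2]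
      simp only
      rw [(h1 x hx).2, (h2 y hy).2]
      ring

theorem IsHomotheticalSurface.classification {I J : Set ℝ} {f g : ℝ → ℝ} {X : ℝ × ℝ → L3} {K : ℝ}
    (h : IsHomotheticalSurface I J f g X) (hX : IsNondegenerateOn (I ×ˢ J) X)
    (hK : ∀ p ∈ I ×ˢ J, gaussK X p = K) :
    K = 0 ∧ (IsCoordinateCylinder (I ×ˢ J) X ∨ IsExponentialForm I J (fun x y => f x * g y) ∨
      IsPowerForm I J (fun x y => f x * g y)) := by
  obtain ⟨ε₁, ε₂, hε₁, hε₂, hgauss⟩ := h.gauss hX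
  obtain ⟨hI, hIc, hIn⟩ := h.interval_left
  obtain ⟨hJ, hJc, hJn⟩ := h.interval_right
  have heq : ∀ x ∈ I, ∀ y ∈ J, _ := fun x hx y hy =>
    (hK (x, y) ⟨hx, hy⟩) ▸ (hgauss x hx y hy).2
  have hK0 : K = 0 := curvature_eq_zero_of_product hI hIc hIn hJ hJc hJn h.smooth_left
    h.smooth_right hε₁ hε₂ (fun x hx y hy => (hgauss x hx y hy).1) heq
  refine ⟨hK0, ?_⟩
  have hconst : ∀ {I : Set ℝ} {f : ℝ → ℝ}, IsOpen I → I.OrdConnected → ContDiffOn ℝ ∞ f I →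
      (∀ x ∈ I, deriv f x = 0) → ∃ c, ∀ x ∈ I, f x = c := fun hI hIc hf h0 =>
    hI.exists_is_const_of_deriv_eq_zero hIc.isPreconnected (hf.differentiableOn (by simp)) h0
  by_cases hf : ∀ x ∈ I, deriv f x = 0
  · obtain ⟨c, hc⟩ := hconst hI hIc h.smooth_left hf
    exact Or.inl (h.isCoordinateCylinder_of_left hX hc)
  by_cases hg : ∀ y ∈ J, deriv g y = 0
  · obtain ⟨c, hc⟩ := hconst hJ hJc h.smooth_right hg
    exact Or.inl (h.isCoordinateCylinder_of_right hX hc)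
  push Not at hf hg
  obtain ⟨x₀, hx₀, hfx⟩ := hf
  obtain ⟨y₀, hy₀, hgy⟩ := hg
  refine Or.inr (exponential_or_power_of_flat h.interval_left h.interval_right h.smooth_left
    h.smooth_right (fun x hx y hy => ?_) hx₀ hy₀ hfx hgy)
  have h1 := heq x hx y hy
  rw [hK0, zero_mul] at h1
  linarith

end Lorentz

theorem mainTheorem4 :
    (∀ (I J : Set ℝ) (α β : ℝ → Lorentz.L3) (X : ℝ × ℝ → Lorentz.L3),
      Lorentz.IsTranslationSurface I J α β X → Lorentz.IsNondegenerateOn (I ×ˢ J) X →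
      (∀ p ∈ I ×ˢ J, Lorentz.gaussK X p = 0) →
      Lorentz.IsCylindrical (I ×ˢ J) X) ∧
    (∀ (I J : Set ℝ) (α β : ℝ → Lorentz.L3) (X : ℝ × ℝ → Lorentz.L3) (K : ℝ),
      Lorentz.IsTranslationSurface I J α β X → Lorentz.IsNondegenerateOn (I ×ˢ J) X →
      (Lorentz.IsPlanarOn I α ∨ Lorentz.IsPlanarOn J β) → K ≠ 0 →
      ¬ ∀ p ∈ I ×ˢ J, Lorentz.gaussK X p = K) ∧
    (∀ (I J : Set ℝ) (f g : ℝ → ℝ) (X : ℝ × ℝ → Lorentz.L3) (K : ℝ),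
      Lorentz.IsHomotheticalSurface I J f g X → Lorentz.IsNondegenerateOn (I ×ˢ J) X →
      (∀ p ∈ I ×ˢ J, Lorentz.gaussK X p = K) →
      K = 0 ∧
        (Lorentz.IsCoordinateCylinder (I ×ˢ J) X ∨
          Lorentz.IsExponentialForm I J (fun x y => f x * g y) ∨
          Lorentz.IsPowerForm I J (fun x y => f x * g y))) := by
  exact ⟨fun _ _ _ _ _ h hX hK => h.isCylindrical hX hK,
    fun _ _ _ _ _ _ h hX hP hK => h.not_const_gaussK hX hP hK,
    fun _ _ _ _ _ _ h hX hK => h.classification hX hK⟩
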